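/- Let $\alpha>0$, $\alpha\neq 1$. Let $g=\rho(z)|dz|^2$ be a smooth conformal metric ($\rho>0$) on $\mathbb C\setminus\{0\}$ of constant Gauss curvature $K=-\frac{\Delta\log\rho}{2\rho}=1$, which, as a metric on the Riemann sphere $\mathbb C\cup\{\infty\}$, has conical singularities of the same angle $2\pi\alpha$ at $z=0$ and at $z=\infty$. Here $g$ has a conical singularity of angle $2\pi\alpha$ at a point $P$ if near $P$ there is a local complex coordinate $\zeta$ with $\zeta(P)=0$ such that $g=e^{2\varphi(\zeta)}|d\zeta|^2$ for $\zeta\ne 0$ and $\varphi(\zeta)-(\alpha-1)\ln|\zeta|$ extends continuously to $\zeta=0$. Then, up to a change of coordinate $z\to pz$ with a constant $p\in\mathbb C\setminus\{0\}$ (that is, in the coordinate $w$ defined by $z=pw$ for a suitable $p\neq0$, and writing $z$ again for $w$), the following holds on $\mathbb C\setminus\{0\}$. (1) If $\alpha$ is not a positive integer, then $$g=\frac{4\alpha^{2}|z|^{2(\alpha-1)}}{(1+|z|^{2\alpha})^{2}}\,|dz|^2 .$$ (2) If $\alpha$ is a positive integer, then $$g=\frac{4\alpha^{2}|z|^{2(\alpha-1)}}{(1+|z^{\alpha}+b|^{2})^{2}}\,|dz|^2$$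 for some constant $b\in\mathbb R$. -/

import Mathlib

open Set Filter Topology
open scoped OnePoint

noncomputable section

/-- The coordinate `w = 1 / z` at infinity on the Riemann sphere `ℂ ∪ {∞} = OnePoint ℂ`, as the
inverse chart `w ↦ 1 / w`, with `1 / 0 = ∞`. The other standard inverse chart is the inclusion
`ℂ → OnePoint ℂ`. -/
def sphereAtInfinity (w : ℂ) : OnePoint ℂ :=
  if w = 0 then ∞ else ((w⁻¹ : ℂ) : OnePoint ℂ)

/-- A function on an (open) subset `U` of the Riemann sphere is holomorphic if it is so in the two
standard coordinates `z` and `w = 1 / z`. -/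
def SphereHolomorphicOn (ζ : OnePoint ℂ → ℂ) (U : Set (OnePoint ℂ)) : Prop :=
  DifferentiableOn ℂ (fun z : ℂ => ζ (z : OnePoint ℂ)) {z : ℂ | (z : OnePoint ℂ) ∈ U} ∧
  DifferentiableOn ℂ (fun w : ℂ => ζ (sphereAtInfinity w)) {w : ℂ | sphereAtInfinity w ∈ U}

/-- A local complex coordinate chart `(U, ζ)` of the Riemann sphere with `ζ P = 0`: an injective
holomorphic function on an open neighbourhood of `P`. -/
structure IsSphereCoordinateAt (P : OnePoint ℂ) (U : Set (OnePoint ℂ)) (ζ : OnePoint ℂ → ℂ) :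
    Prop where
  isOpen : IsOpen U
  mem : P ∈ U
  holo : SphereHolomorphicOn ζ U
  inj : InjOn ζ U
  zero : ζ P = 0

/-- A smooth conformal (Riemannian) metric `g = ρ(z) |dz|²` on a plane domain `D`, given by its
density `ρ`. Only the values of `ρ` on `D` matter. -/
structure ConformalMetric (D : Set ℂ) where
  density : ℂ → ℝ
  smooth : ContDiffOn ℝ ((⊤ : ℕ∞) : WithTop ℕ∞) density D
  pos : ∀ z ∈ D, 0 < density z

/-- The Gauss curvature `K = -Δ(log ρ) / (2 ρ)` of the conformal metric `ρ |dz|²`; with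
`ρ = e^{2φ}` this is `-e^{-2φ} Δφ`. -/
def ConformalMetric.gaussCurvature {D : Set ℂ} (g : ConformalMetric D) (z : ℂ) : ℝ :=
  -(Laplacian.laplacian (fun x : ℂ => Real.log (g.density x)) z) / (2 * g.density z)

/-- The conformal metric `g`, defined on the domain `D` of the sphere, has a conical singularity of
angle `2πα` at the point `P` of the sphere: there are a local complex coordinate `(U, ζ)` with
`ζ P = 0` and a function `φ` such that on `U` without `P` (which is part of `D`) one has
`g = e^{2φ(ζ)} |dζ|²`, that is `ρ(z) = e^{2φ(ζ(z))} |ζ'(z)|²`, and `φ(x) - (α - 1) log |x|`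
extends continuously to `x = 0`. -/
def ConformalMetric.HasConicalSingularity {D : Set ℂ} (g : ConformalMetric D)
    (P : OnePoint ℂ) (α : ℝ) : Prop :=
  ∃ (U : Set (OnePoint ℂ)) (ζ : OnePoint ℂ → ℂ) (φ : ℂ → ℝ),
    IsSphereCoordinateAt P U ζ ∧
    (∀ Q ∈ U, Q ≠ P → ∃ z ∈ D, Q = (z : OnePoint ℂ) ∧
      g.density z = Real.exp (2 * φ (ζ (z : OnePoint ℂ))) *
        ‖deriv (fun x : ℂ => ζ (x : OnePoint ℂ)) z‖ ^ 2) ∧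
    ∃ L : ℝ, Tendsto (fun x : ℂ => φ x - (α - 1) * Real.log ‖x‖) (𝓝[≠] 0) (𝓝 L)

/-- The density at `w` of the metric `g = ρ |dz|²` in the new coordinate `w` with `z = ψ(w)`:
`ρ(ψ(w)) |ψ'(w)|²`. -/
def ConformalMetric.densityInCoordinate {D : Set ℂ} (g : ConformalMetric D) (ψ : ℂ → ℂ)
    (w : ℂ) : ℝ :=
  g.density (ψ w) * ‖deriv ψ w‖ ^ 2

end

/-! Put `z = exp s` and `u(s) = log (|z|² ρ(z))`. Curvature one becomes the Liouville equation `Δu =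
-2 e^u` on the whole plane, `u` has period `2πi`, and the two cone conditions say that `u - 2α Re s`
converges as `Re s → -∞` and `u + 2α Re s` as `Re s → +∞`.

The Liouville equation makes `u_ss - u_s² / 2` holomorphic (`differentiable_schwarz`). At both ends
this function tends to `-α² / 2`. Only uniform closeness of `u` to an affine function is known
there, so an interior estimate is needed: the mean value property against a bump moves derivatives
off `u`, and a Caccioppoli identity controls the quadratic terms (`exists_norm_schwarzShift_le`,
`tendsto_schwarzShift`). Periodicity then makes the function bounded, and Liouville's theorem gives
the constant `-α² / 2` everywhere (`schwarzShift_eq_zero`).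

For `V = e^{-u/2}` this is the linear equation `V_ss = (α² / 4) V`, whence, with `s = x + iy`, `V =
a e^{αx} + b e^{-αx} + c cos αy + d sin αy`. The Liouville equation itself becomes `V ΔV - |∇V|² =
1`, that is `α² (4ab - c² - d²) = 1` (`exists_exp_neg_half_eq`). Periodicity forces `c = d = 0`
unless `α` is an integer, and a rescaling of `z` equalizes the two remaining terms. For integral `α
= n`, completing the square in `z^n` and choosing `p` as an `n`-th root gives the second normal
form. -/

open MeasureTheory

/-! ### Calculus of directional derivatives on the plane -/

/-- The derivative of a real function on `ℂ` in the direction `v`. -/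
noncomputable def dirDeriv (v : ℂ) (f : ℂ → ℝ) (s : ℂ) : ℝ := fderiv ℝ f s v

section DirDeriv

variable {f g : ℂ → ℝ}

@[fun_prop]
theorem contDiff_dirDeriv (v : ℂ) (hf : ContDiff ℝ (⊤ : ℕ∞) f) :
    ContDiff ℝ (⊤ : ℕ∞) (dirDeriv v f) :=
  (hf.fderiv_right (m := (⊤ : ℕ∞)) (by simp)).clm_apply contDiff_const

theorem ContDiff.diffAt (hf : ContDiff ℝ (⊤ : ℕ∞) f) (s : ℂ) : DifferentiableAt ℝ f s :=
  (hf.differentiable (by simp)).differentiableAt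

theorem dirDeriv_add (v : ℂ) (hf : ContDiff ℝ (⊤ : ℕ∞) f) (hg : ContDiff ℝ (⊤ : ℕ∞) g) :
    dirDeriv v (fun s => f s + g s) = fun s => dirDeriv v f s + dirDeriv v g s := by
  ext s
  simp [dirDeriv, fderiv_fun_add (hf.diffAt s) (hg.diffAt s)]

theorem dirDeriv_sub (v : ℂ) (hf : ContDiff ℝ (⊤ : ℕ∞) f) (hg : ContDiff ℝ (⊤ : ℕ∞) g) :
    dirDeriv v (fun s => f s - g s) = fun s => dirDeriv v f s - dirDeriv v g s := by
  ext s
  simp [dirDeriv, fderiv_fun_sub (hf.diffAt s) (hg.diffAt s)]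

theorem dirDeriv_mul (v : ℂ) (hf : ContDiff ℝ (⊤ : ℕ∞) f) (hg : ContDiff ℝ (⊤ : ℕ∞) g) :
    dirDeriv v (fun s => f s * g s) = fun s => f s * dirDeriv v g s + g s * dirDeriv v f s := by
  ext s
  simp [dirDeriv, fderiv_fun_mul (hf.diffAt s) (hg.diffAt s)]

theorem dirDeriv_const_mul (v : ℂ) (c : ℝ) (hf : ContDiff ℝ (⊤ : ℕ∞) f) :
    dirDeriv v (fun s => c * f s) = fun s => c * dirDeriv v f s := by
  ext s
  simp [dirDeriv, fderiv_const_mul (hf.diffAt s)]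

theorem dirDeriv_exp (v : ℂ) (hf : ContDiff ℝ (⊤ : ℕ∞) f) :
    dirDeriv v (fun s => Real.exp (f s)) = fun s => Real.exp (f s) * dirDeriv v f s := by
  ext s
  simp [dirDeriv, fderiv_exp (hf.diffAt s)]

theorem dirDeriv_const (v : ℂ) (c : ℝ) : dirDeriv v (fun _ => c) = fun _ => 0 := by
  ext s
  simp [dirDeriv]

theorem dirDeriv_re (v : ℂ) : dirDeriv v (fun s => s.re) = fun _ => v.re := by
  ext s
  exact congrArg (fun L : ℂ →L[ℝ] ℝ => L v) Complex.reCLM.fderiv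

theorem dirDeriv_im (v : ℂ) : dirDeriv v (fun s => s.im) = fun _ => v.im := by
  ext s
  exact congrArg (fun L : ℂ →L[ℝ] ℝ => L v) Complex.imCLM.fderiv

theorem dirDeriv_comm (v w : ℂ) (hf : ContDiff ℝ (⊤ : ℕ∞) f) :
    dirDeriv v (dirDeriv w f) = dirDeriv w (dirDeriv v f) := by
  ext s
  have hd : DifferentiableAt ℝ (fderiv ℝ f) s :=
    ((hf.fderiv_right (m := (⊤ : ℕ∞)) (by simp)).differentiable (by simp)).differentiableAt
  have key : ∀ a b : ℂ, dirDeriv a (dirDeriv b f) s = fderiv ℝ (fderiv ℝ f) s a b := by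
    intro a b
    have : HasFDerivAt (dirDeriv b f)
        ((ContinuousLinearMap.apply ℝ ℝ b).comp (fderiv ℝ (fderiv ℝ f) s)) s :=
      (ContinuousLinearMap.apply ℝ ℝ b).hasFDerivAt.comp s hd.hasFDerivAt
    simp [dirDeriv, this.fderiv]
  rw [key, key]
  have : IsSymmSndFDerivAt ℝ f s := hf.contDiffAt.isSymmSndFDerivAt 
    (by simpa using WithTop.coe_le_coe.mpr (le_top : (2 : ℕ∞) ≤ ⊤))
  exact this v w

theorem dirDeriv_eq_combination (v : ℂ) (s : ℂ) :
    dirDeriv v f s = v.re * dirDeriv 1 f s + v.im * dirDeriv Complex.I f s := by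
  have : v = v.re • (1 : ℂ) + v.im • Complex.I := by
    simp [Complex.re_add_im]
  conv_lhs => rw [this]
  simp only [dirDeriv, map_add, map_smul, smul_eq_mul]

theorem dirDeriv_comp_add (v a : ℂ) :
    dirDeriv v (fun s => f (s + a)) = fun s => dirDeriv v f (s + a) := by
  ext s
  simp [dirDeriv, fderiv_comp_add_right]

end DirDeriv

/-! ### The Schwarzian of a Liouville solution and its holomorphy -/

open Complex in
/-- Sum of the second derivatives in the two coordinate directions. -/
noncomputable def lap (f : ℂ → ℝ) (s : ℂ) : ℝ :=
  dirDeriv 1 (dirDeriv 1 f) s + dirDeriv I (dirDeriv I f) s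

/-- The real part of eight times `u_ss - u_s ^ 2 / 2`, where `u_s` is the Wirtinger derivative. -/
noncomputable def schwarzRe (u : ℂ → ℝ) (s : ℂ) : ℝ :=
  2 * (dirDeriv 1 (dirDeriv 1 u) s - dirDeriv Complex.I (dirDeriv Complex.I u) s) -
    dirDeriv 1 u s * dirDeriv 1 u s + dirDeriv Complex.I u s * dirDeriv Complex.I u s

/-- The imaginary part of eight times `u_ss - u_s ^ 2 / 2`, where `u_s` is the Wirtinger
derivative. -/
noncomputable def schwarzIm (u : ℂ → ℝ) (s : ℂ) : ℝ :=
  -4 * dirDeriv Complex.I (dirDeriv 1 u) s + 2 * (dirDeriv 1 u s * dirDeriv Complex.I u s)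

@[fun_prop]
theorem contDiff_schwarzRe {u : ℂ → ℝ} (hu : ContDiff ℝ (⊤ : ℕ∞) u) :
    ContDiff ℝ (⊤ : ℕ∞) (schwarzRe u) := by
  unfold schwarzRe
  fun_prop

@[fun_prop]
theorem contDiff_schwarzIm {u : ℂ → ℝ} (hu : ContDiff ℝ (⊤ : ℕ∞) u) :
    ContDiff ℝ (⊤ : ℕ∞) (schwarzIm u) := by
  unfold schwarzIm
  fun_prop

theorem dirDeriv_schwarzRe {u : ℂ → ℝ} (hu : ContDiff ℝ (⊤ : ℕ∞) u) (v s : ℂ) :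
    dirDeriv v (schwarzRe u) s =
      2 * (dirDeriv v (dirDeriv 1 (dirDeriv 1 u)) s -
        dirDeriv v (dirDeriv Complex.I (dirDeriv Complex.I u)) s) -
      2 * (dirDeriv 1 u s * dirDeriv v (dirDeriv 1 u) s) +
      2 * (dirDeriv Complex.I u s * dirDeriv v (dirDeriv Complex.I u) s) := by
  unfold schwarzRe
  rw [dirDeriv_add v (by fun_prop) (by fun_prop), dirDeriv_sub v (by fun_prop) (by fun_prop),
    dirDeriv_const_mul v 2 (by fun_prop), dirDeriv_sub v (by fun_prop) (by fun_prop),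
    dirDeriv_mul v (by fun_prop) (by fun_prop), dirDeriv_mul v (by fun_prop) (by fun_prop)]
  ring

theorem dirDeriv_schwarzIm {u : ℂ → ℝ} (hu : ContDiff ℝ (⊤ : ℕ∞) u) (v s : ℂ) :
    dirDeriv v (schwarzIm u) s =
      -4 * dirDeriv v (dirDeriv Complex.I (dirDeriv 1 u)) s +
      2 * (dirDeriv 1 u s * dirDeriv v (dirDeriv Complex.I u) s +
        dirDeriv Complex.I u s * dirDeriv v (dirDeriv 1 u) s) := by
  unfold schwarzIm
  rw [dirDeriv_add v (by fun_prop) (by fun_prop), dirDeriv_const_mul v (-4) (by fun_prop),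
    dirDeriv_const_mul v 2 (by fun_prop), dirDeriv_mul v (by fun_prop) (by fun_prop)]

/-- For a solution of the Liouville equation the function `8 (u_ss - u_s ^ 2 / 2)` is entire. -/
theorem differentiable_schwarz {u : ℂ → ℝ} (hu : ContDiff ℝ (⊤ : ℕ∞) u)
    (hL : ∀ s, lap u s = -2 * Real.exp (u s)) (c : ℝ) :
    Differentiable ℂ (fun s => ((schwarzRe u s + c : ℝ) : ℂ) + (schwarzIm u s : ℂ) * Complex.I) := by
  -- Differentiating the Liouville equation reproduces `e^u`; replacing it by `Δu` leaves a relation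
  -- between derivatives of `u` alone.
  have hL' : ∀ v s, dirDeriv v (dirDeriv 1 (dirDeriv 1 u)) s +
      dirDeriv v (dirDeriv Complex.I (dirDeriv Complex.I u)) s =
        (dirDeriv 1 (dirDeriv 1 u) s + dirDeriv Complex.I (dirDeriv Complex.I u) s)
          * dirDeriv v u s := by
    intro v s
    have h := congrFun (congrArg (dirDeriv v) (funext hL)) s
    have h1 : dirDeriv v (lap u) s = dirDeriv v (dirDeriv 1 (dirDeriv 1 u)) s +
      dirDeriv v (dirDeriv Complex.I (dirDeriv Complex.I u)) s := by
      unfold lap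
      rw [dirDeriv_add v (by fun_prop) (by fun_prop)]
    rw [dirDeriv_const_mul v (-2) (by fun_prop), dirDeriv_exp v hu] at h
    have h2 := hL s
    simp only [lap] at h2
    rw [h2, ← h1]
    simp only [] at h
    rw [h]; ring
  intro s
  have hd1 := ((contDiff_schwarzRe hu).diffAt s).hasFDerivAt
  have hd2 := ((contDiff_schwarzIm hu).diffAt s).hasFDerivAt
  have hd : HasFDerivAt (fun s => ((schwarzRe u s + c : ℝ) : ℂ) + (schwarzIm u s : ℂ) * Complex.I)
      (Complex.ofRealCLM.comp (fderiv ℝ (schwarzRe u) s) +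
        (Complex.ofRealCLM.comp (fderiv ℝ (schwarzIm u) s)).smulRight Complex.I) s := by
    refine HasFDerivAt.add ?_ ?_
    · exact Complex.ofRealCLM.hasFDerivAt.comp s (hd1.add_const c)
    · exact (Complex.ofRealCLM.hasFDerivAt.comp s hd2).mul_const' Complex.I
  rw [differentiableAt_complex_iff_differentiableAt_real]
  refine ⟨hd.differentiableAt, ?_⟩
  rw [hd.fderiv]
  -- The Cauchy–Riemann equations. Once mixed derivatives are put in a common order, each is twice
  -- the differentiated Liouville equation, up to sign.
  have e1 : fderiv ℝ (schwarzRe u) s 1 = fderiv ℝ (schwarzIm u) s Complex.I := by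
    have a := dirDeriv_schwarzRe hu 1 s
    have b := dirDeriv_schwarzIm hu Complex.I s
    have c := hL' 1 s
    rw [dirDeriv_comm 1 Complex.I (by fun_prop), dirDeriv_comm 1 Complex.I (by fun_prop)] at a
    rw [dirDeriv_comm 1 Complex.I (by fun_prop), dirDeriv_comm 1 Complex.I (by fun_prop)] at c
    simp only [dirDeriv] at *
    rw [a, b]
    linear_combination 2 * c
  have e2 : fderiv ℝ (schwarzRe u) s Complex.I = - fderiv ℝ (schwarzIm u) s 1 := by
    have a := dirDeriv_schwarzRe hu Complex.I s
    have b := dirDeriv_schwarzIm hu 1 s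
    have c := hL' Complex.I s
    rw [dirDeriv_comm 1 Complex.I (by fun_prop), dirDeriv_comm 1 Complex.I hu] at b
    simp only [dirDeriv] at *
    rw [a, b]
    linear_combination -2 * c
  apply Complex.ext <;> simp [e1, e2]

/-! ### Radial bump, integration by parts and the weighted mean value property -/

/-- A smooth radial bump function supported in the closed unit disc of `ℂ`. -/
noncomputable def radialBump (s : ℂ) : ℝ := Real.smoothTransition (1 - Complex.normSq s)

theorem contDiff_normSq : ContDiff ℝ (⊤ : ℕ∞) (fun s : ℂ => Complex.normSq s) := by
  have : (fun s : ℂ => Complex.normSq s) = fun s => Complex.reCLM s * Complex.reCLM s +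
      Complex.imCLM s * Complex.imCLM s := by
    ext s; simp [Complex.normSq_apply]
  rw [this]
  fun_prop

theorem contDiff_radialBump : ContDiff ℝ (⊤ : ℕ∞) radialBump :=
  Real.smoothTransition.contDiff.comp (contDiff_const.sub contDiff_normSq)

theorem radialBump_nonneg (s : ℂ) : 0 ≤ radialBump s := Real.smoothTransition.nonneg _

theorem tsupport_radialBump_subset : tsupport radialBump ⊆ Metric.closedBall 0 1 := by
  refine closure_minimal (fun s hs => ?_) Metric.isClosed_closedBall
  rw [mem_closedBall_zero_iff]
  by_contra! h
  refine hs (Real.smoothTransition.zero_of_nonpos ?_)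
  rw [Complex.normSq_eq_norm_sq]
  nlinarith

theorem hasCompactSupport_radialBump : HasCompactSupport radialBump :=
  (isCompact_closedBall (0 : ℂ) 1).of_isClosed_subset (isClosed_tsupport _)
    tsupport_radialBump_subset

theorem integral_radialBump_pos : 0 < ∫ s, radialBump s := by
  refine contDiff_radialBump.continuous.integral_pos_of_hasCompactSupport_nonneg_nonzero
    hasCompactSupport_radialBump radialBump_nonneg (x := 0) ?_
  simp [radialBump]

theorem dirDeriv_eq_zero_of_notMem {f : ℂ → ℝ} (v : ℂ) {s : ℂ} (h : s ∉ tsupport f) :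
    dirDeriv v f s = 0 := by
  simp [dirDeriv, image_eq_zero_of_notMem_tsupport (fun h' => h (tsupport_fderiv_subset ℝ h'))]

theorem tsupport_dirDeriv_subset (v : ℂ) (f : ℂ → ℝ) : tsupport (dirDeriv v f) ⊆ tsupport f :=
  closure_minimal (fun _ hs => by_contra fun h => hs (dirDeriv_eq_zero_of_notMem v h))
    (isClosed_tsupport _)

theorem HasCompactSupport.dirDeriv {f : ℂ → ℝ} (hf : HasCompactSupport f) (v : ℂ) :
    HasCompactSupport (dirDeriv v f) :=
  hf.of_isClosed_subset (isClosed_tsupport _) (tsupport_dirDeriv_subset v f)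

theorem integrable_mul_of_hasCompactSupport {f k : ℂ → ℝ} (hf : Continuous f) (hk : Continuous k)
    (hc : HasCompactSupport k) : Integrable (fun s => f s * k s) :=
  (hf.mul hk).integrable_of_hasCompactSupport hc.mul_left

theorem integral_dirDeriv_mul {f k : ℂ → ℝ} (hf : ContDiff ℝ (⊤ : ℕ∞) f)
    (hk : ContDiff ℝ (⊤ : ℕ∞) k) (hc : HasCompactSupport k) (v : ℂ) :
    ∫ s, dirDeriv v f s * k s = - ∫ s, f s * dirDeriv v k s := by
  have h := integral_mul_fderiv_eq_neg_fderiv_mul_of_integrable (μ := volume) (f := f) (g := k)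
    (v := v)
    (integrable_mul_of_hasCompactSupport (contDiff_dirDeriv v hf).continuous hk.continuous hc)
    (integrable_mul_of_hasCompactSupport hf.continuous (contDiff_dirDeriv v hk).continuous
      (hc.dirDeriv v))
    (integrable_mul_of_hasCompactSupport hf.continuous hk.continuous hc)
    (fun s _ => hf.diffAt s) (fun s _ => hk.diffAt s)
  simp only [dirDeriv, h, neg_neg]

theorem integral_dirDeriv_dirDeriv_mul {f k : ℂ → ℝ} (hf : ContDiff ℝ (⊤ : ℕ∞) f)
    (hk : ContDiff ℝ (⊤ : ℕ∞) k) (hc : HasCompactSupport k) (v w : ℂ) :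
    ∫ s, dirDeriv v (dirDeriv w f) s * k s = ∫ s, f s * dirDeriv w (dirDeriv v k) s := by
  rw [integral_dirDeriv_mul (by fun_prop) hk hc,
    integral_dirDeriv_mul hf (by fun_prop) (hc.dirDeriv v), neg_neg]

theorem abs_integral_mul_le {f k : ℂ → ℝ} (hf : Continuous f) (hk : Continuous k)
    (hc : HasCompactSupport k) {ε : ℝ} (h : ∀ s ∈ tsupport k, |f s| ≤ ε) :
    |∫ s, f s * k s| ≤ ε * ∫ s, |k s| := by
  rw [← integral_const_mul]
  refine (abs_integral_le_integral_abs).trans (integral_mono ?_ ?_ fun s => ?_)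
  · exact (integrable_mul_of_hasCompactSupport hf hk hc).abs
  · exact ((hk.integrable_of_hasCompactSupport hc).abs).const_mul ε
  · by_cases hs : s ∈ tsupport k
    · simpa only [abs_mul] using mul_le_mul_of_nonneg_right (h s hs) (abs_nonneg _)
    · simp [image_eq_zero_of_notMem_tsupport hs]

open Complex in
/-- The mean value property of entire functions against a radial weight. -/
theorem integral_mul_radialBump {F : ℂ → ℂ} (hF : Differentiable ℂ F) :
    ∫ s, F s * (radialBump s : ℂ) = F 0 * ((∫ s, radialBump s : ℝ) : ℂ) := by
  have hpolar : ∀ p : ℝ × ℝ, radialBump (Complex.polarCoord.symm p) = radialBump (p.1 : ℂ) := by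
    intro p
    simp only [radialBump, normSq_eq_norm_sq, Complex.norm_polarCoord_symm, norm_real,
      Real.norm_eq_abs]
  -- Stated for every entire `G` so that `G = 1` identifies the radial integral with the mass of the
  -- bump.
  have key : ∀ G : ℂ → ℂ, Differentiable ℂ G → ∫ s, G s * (radialBump s : ℂ) =
      ∫ r in Ioi (0 : ℝ), (r * radialBump (r : ℂ) * (2 * Real.pi) : ℝ) * G 0 := by
    intro G hG
    have hGc := hG.continuous
    have hχ : Continuous fun s : ℂ => radialBump s := contDiff_radialBump.continuous
    rw [← Complex.integral_comp_polarCoord_symm, polarCoord_target, Measure.volume_eq_prod,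
      setIntegral_prod]
    · refine setIntegral_congr_fun measurableSet_Ioi fun r hr => ?_
      have hmean : ∫ θ in Ioo (-Real.pi) Real.pi, G (Complex.polarCoord.symm (r, θ)) =
          (2 * Real.pi : ℝ) * G 0 := by
        have h1 := (hG.diffContOnCl (s := Metric.ball 0 |r|)).circleAverage
        rw [Real.circleAverage_eq_integral_add (-Real.pi)] at h1
        rw [← integral_Ioc_eq_integral_Ioo, ← intervalIntegral.integral_of_le
          (by linarith [Real.pi_pos])]
        rw [← h1]
        rw [intervalIntegral.integral_comp_add_right (fun θ => G (circleMap 0 r θ))]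
        have : (2 * Real.pi + -Real.pi) = Real.pi := by ring
        rw [zero_add, this, real_smul, ← mul_assoc, ← ofReal_mul, mul_inv_cancel₀
          (by positivity), ofReal_one, one_mul]
        congr 1; ext θ
        simp [circleMap, Complex.exp_mul_I]
      simp only [hpolar]
      rw [integral_smul, integral_mul_const, hmean, real_smul]
      push_cast; ring
    · have hcont : Continuous fun p : ℝ × ℝ => p.1 • (G (Complex.polarCoord.symm p) *
          (radialBump (Complex.polarCoord.symm p) : ℂ)) := by
        simp only [Complex.polarCoord_symm_apply]
        fun_prop
      have hint : IntegrableOn (fun p : ℝ × ℝ => p.1 • (G (Complex.polarCoord.symm p) *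
          (radialBump (Complex.polarCoord.symm p) : ℂ)))
          (Icc (0 : ℝ) 1 ×ˢ Icc (-Real.pi) Real.pi) :=
        hcont.continuousOn.integrableOn_compact (isCompact_Icc.prod isCompact_Icc)
      refine hint.of_forall_sdiff_eq_zero (measurableSet_Ioi.prod measurableSet_Ioo) ?_
      rintro ⟨r, θ⟩ ⟨⟨hr, hθ⟩, hn⟩
      have hr1 : 1 < r := by
        by_contra! h
        exact hn ⟨⟨(mem_Ioi.1 hr).le, h⟩, Ioo_subset_Icc_self hθ⟩
      have : radialBump (r : ℂ) = 0 := by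
        refine Real.smoothTransition.zero_of_nonpos ?_
        rw [normSq_ofReal]
        nlinarith
      simp only [hpolar, this]
      simp
  have h1 := key F hF
  have h2 := key (fun _ => 1) (by fun_prop)
  rw [integral_mul_const] at h1 h2
  simp only [one_mul, mul_one] at h2
  rw [h1, mul_comm, ← h2, integral_complex_ofReal]

/-! ### Interior estimate and decay at the ends of the cylinder -/

/-- The function `8 (u_ss - u_s ^ 2 / 2) + 4 l ^ 2`. -/
noncomputable def schwarzShift (l : ℝ) (u : ℂ → ℝ) (s : ℂ) : ℂ :=
  ((schwarzRe u s + 4 * l ^ 2 : ℝ) : ℂ) + (schwarzIm u s : ℂ) * Complex.I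

theorem schwarzShift_re (l : ℝ) (u : ℂ → ℝ) (s : ℂ) :
    (schwarzShift l u s).re = schwarzRe u s + 4 * l ^ 2 := by
  simp only [schwarzShift, Complex.add_re, Complex.re_ofReal_mul, Complex.ofReal_re, Complex.I_re,
    mul_zero, add_zero]

theorem schwarzShift_im (l : ℝ) (u : ℂ → ℝ) (s : ℂ) :
    (schwarzShift l u s).im = schwarzIm u s := by
  simp only [schwarzShift, Complex.add_im, Complex.im_ofReal_mul, Complex.ofReal_im, Complex.I_im,
    mul_one, zero_add]

theorem dirDeriv_add_affine {W : ℂ → ℝ} (hW : ContDiff ℝ (⊤ : ℕ∞) W) (l c : ℝ) (v : ℂ) :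
    dirDeriv v (fun s => W s + (2 * l * s.re + c)) = fun s => dirDeriv v W s + 2 * l * v.re := by
  have hre : ContDiff ℝ (⊤ : ℕ∞) (fun s : ℂ => s.re) := Complex.reCLM.contDiff
  rw [dirDeriv_add v hW (by fun_prop), dirDeriv_add v (by fun_prop) contDiff_const,
    dirDeriv_const_mul v _ hre, dirDeriv_re, dirDeriv_const]
  simp

theorem dirDeriv_dirDeriv_add_affine {W : ℂ → ℝ} (hW : ContDiff ℝ (⊤ : ℕ∞) W) (l c : ℝ) (v w : ℂ) :
    dirDeriv w (dirDeriv v (fun s => W s + (2 * l * s.re + c))) = dirDeriv w (dirDeriv v W) := by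
  rw [dirDeriv_add_affine hW, dirDeriv_add w (by fun_prop) contDiff_const, dirDeriv_const]
  simp

theorem lap_add_affine {W : ℂ → ℝ} (hW : ContDiff ℝ (⊤ : ℕ∞) W) (l c : ℝ) (s : ℂ) :
    lap (fun s => W s + (2 * l * s.re + c)) s = lap W s := by
  simp only [lap, dirDeriv_dirDeriv_add_affine hW]

/-- The Caccioppoli identity. -/
theorem integral_gradient_sq_mul {W k : ℂ → ℝ} (hW : ContDiff ℝ (⊤ : ℕ∞) W)
    (hk : ContDiff ℝ (⊤ : ℕ∞) k) (hc : HasCompactSupport k) :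
    ∫ s, (dirDeriv 1 W s * dirDeriv 1 W s + dirDeriv Complex.I W s * dirDeriv Complex.I W s) * k s =
      (1 / 2) * ((∫ s, (W s * W s) * dirDeriv 1 (dirDeriv 1 k) s) +
        ∫ s, (W s * W s) * dirDeriv Complex.I (dirDeriv Complex.I k) s) -
      ∫ s, (W s * lap W s) * k s := by
  have hlap : ContDiff ℝ (⊤ : ℕ∞) (lap W) := by unfold lap; fun_prop
  -- Summed over the two directions this is `Δ(W²) = 2 |∇W|² + 2 W ΔW`; both derivatives of `W²` are
  -- then moved onto `k`.
  have hd : ∀ v, dirDeriv v (dirDeriv v fun s => W s * W s) = fun s =>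
      2 * (dirDeriv v W s * dirDeriv v W s) + 2 * (W s * dirDeriv v (dirDeriv v W) s) := by
    intro v
    rw [dirDeriv_mul v hW hW, dirDeriv_add v (by fun_prop) (by fun_prop),
      dirDeriv_mul v (by fun_prop) (by fun_prop)]
    ext s; ring
  have hWW : ContDiff ℝ (⊤ : ℕ∞) fun s => W s * W s := by fun_prop
  have hi : ∀ v, Integrable (fun s => dirDeriv v (dirDeriv v fun s => W s * W s) s * k s) :=
    fun v => integrable_mul_of_hasCompactSupport
      (contDiff_dirDeriv v (contDiff_dirDeriv v hWW)).continuous hk.continuous hc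
  rw [← integral_dirDeriv_dirDeriv_mul hWW hk hc 1 1,
    ← integral_dirDeriv_dirDeriv_mul hWW hk hc Complex.I Complex.I,
    ← integral_add (hi 1) (hi Complex.I), ← integral_const_mul, ← integral_sub]
  · congr 1; ext s
    simp only [hd, lap]
    ring
  · exact ((hi 1).add (hi Complex.I)).const_mul _
  · exact integrable_mul_of_hasCompactSupport (hW.continuous.mul hlap.continuous) hk.continuous hc

open Complex in
/-- If `u` is close to an affine function `2 l Re s + c` and its Laplacian is small on the unit disc,
then `8 (u_ss - u_s ^ 2 / 2) + 4 l ^ 2` is small at the centre. -/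
theorem exists_norm_schwarzShift_le (l : ℝ) : ∃ C : ℝ, 0 ≤ C ∧ ∀ (W : ℂ → ℝ) (c ε : ℝ),
    ContDiff ℝ (⊤ : ℕ∞) W → ε ≤ 1 →
    (∀ s ∈ Metric.closedBall (0 : ℂ) 1, |W s| ≤ ε) →
    (∀ s ∈ Metric.closedBall (0 : ℂ) 1, |lap W s| ≤ ε) →
    Differentiable ℂ (schwarzShift l fun s => W s + (2 * l * s.re + c)) →
    ‖schwarzShift l (fun s => W s + (2 * l * s.re + c)) 0‖ ≤ C * ε := by
  have hm := integral_radialBump_pos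
  set χ := radialBump with hχdef
  have hχ : ContDiff ℝ (⊤ : ℕ∞) χ := contDiff_radialBump
  have hcs : HasCompactSupport χ := hasCompactSupport_radialBump
  let N : (ℂ → ℝ) → ℝ := fun k => ∫ s, |k s|
  have hN : ∀ k, 0 ≤ N k := fun k => integral_nonneg fun s => abs_nonneg _
  -- `ε E` will bound the weighted Dirichlet energy of `W`; `T` adds to two copies of it the linear
  -- terms, whose derivatives have been moved onto the bump.
  let E : ℝ := (1 / 2) * (N (dirDeriv 1 (dirDeriv 1 χ)) + N (dirDeriv I (dirDeriv I χ))) + N χ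
  let T : ℝ := 2 * (N (dirDeriv 1 (dirDeriv 1 χ)) + N (dirDeriv I (dirDeriv I χ))) +
    4 * |l| * N (dirDeriv 1 χ) + 4 * N (dirDeriv 1 (dirDeriv I χ)) + 4 * |l| * N (dirDeriv I χ) +
    2 * E
  have hE : 0 ≤ E := by
    have := hN χ; have := hN (dirDeriv 1 (dirDeriv 1 χ)); have := hN (dirDeriv I (dirDeriv I χ))
    positivity
  have hT : 0 ≤ T := by
    have := hN (dirDeriv 1 χ); have := hN (dirDeriv 1 (dirDeriv 1 χ))
    have := hN (dirDeriv I χ); have := hN (dirDeriv I (dirDeriv I χ))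
    have := hN (dirDeriv 1 (dirDeriv I χ))
    positivity
  refine ⟨T / ∫ s, χ s, by positivity, ?_⟩
  intro W c ε hW hε1 hWε hLε hF
  have hε : 0 ≤ ε := (abs_nonneg _).trans (hWε 0 (by simp))
  have hlap : ContDiff ℝ (⊤ : ℕ∞) (lap W) := by unfold lap; fun_prop
  have hsub : ∀ s ∈ tsupport χ, s ∈ Metric.closedBall (0 : ℂ) 1 :=
    fun s hs => tsupport_radialBump_subset hs
  have hsub1 : ∀ v, ∀ s ∈ tsupport (dirDeriv v χ), s ∈ Metric.closedBall (0 : ℂ) 1 :=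
    fun v s hs => hsub s (tsupport_dirDeriv_subset v χ hs)
  have hsub2 : ∀ v w, ∀ s ∈ tsupport (dirDeriv v (dirDeriv w χ)), s ∈ Metric.closedBall (0 : ℂ) 1 :=
    fun v w s hs => hsub1 w s (tsupport_dirDeriv_subset v _ hs)
  have hcont : ∀ v, Continuous (dirDeriv v W) := fun v => (contDiff_dirDeriv v hW).continuous
  have hcont2 : ∀ v w, Continuous (dirDeriv v (dirDeriv w W)) :=
    fun v w => (contDiff_dirDeriv v (contDiff_dirDeriv w hW)).continuous
  have hint : ∀ f : ℂ → ℝ, Continuous f → Integrable (fun s => f s * χ s) :=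
    fun f hf => integrable_mul_of_hasCompactSupport hf hχ.continuous hcs
  have b1 : ∀ v, |∫ s, dirDeriv v W s * χ s| ≤ ε * N (dirDeriv v χ) := by
    intro v
    rw [integral_dirDeriv_mul hW hχ hcs, abs_neg]
    exact abs_integral_mul_le hW.continuous (contDiff_dirDeriv v hχ).continuous (hcs.dirDeriv v)
      fun s hs => hWε s (hsub1 v s hs)
  have b2 : ∀ v w, |∫ s, dirDeriv v (dirDeriv w W) s * χ s| ≤ ε * N (dirDeriv w (dirDeriv v χ)) := by
    intro v w
    rw [integral_dirDeriv_dirDeriv_mul hW hχ hcs]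
    exact abs_integral_mul_le hW.continuous
      (contDiff_dirDeriv w (contDiff_dirDeriv v hχ)).continuous ((hcs.dirDeriv v).dirDeriv w)
      fun s hs => hWε s (hsub2 w v s hs)
  -- Here `ε ≤ 1` turns the quadratic bound `ε²` into a linear one.
  have hsq : ∀ s ∈ Metric.closedBall (0 : ℂ) 1, |W s * W s| ≤ ε := by
    intro s hs
    rw [abs_mul]
    nlinarith [hWε s hs, abs_nonneg (W s)]
  have bE : ∫ s, (dirDeriv 1 W s * dirDeriv 1 W s + dirDeriv I W s * dirDeriv I W s) * χ s
      ≤ ε * E := by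
    rw [integral_gradient_sq_mul hW hχ hcs]
    have h1 : ∀ v, |∫ s, (W s * W s) * dirDeriv v (dirDeriv v χ) s| ≤
        ε * N (dirDeriv v (dirDeriv v χ)) := fun v =>
      abs_integral_mul_le (hW.continuous.mul hW.continuous)
        (contDiff_dirDeriv v (contDiff_dirDeriv v hχ)).continuous ((hcs.dirDeriv v).dirDeriv v)
        fun s hs => hsq s (hsub2 v v s hs)
    have h2 : |∫ s, (W s * lap W s) * χ s| ≤ ε * N χ :=
      abs_integral_mul_le (hW.continuous.mul hlap.continuous) hχ.continuous hcs fun s hs => by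
        rw [Pi.mul_apply, abs_mul]
        nlinarith [hWε s (hsub s hs), hLε s (hsub s hs), abs_nonneg (W s), abs_nonneg (lap W s)]
    have h11 := (abs_le.1 (h1 1)).2
    have h12 := (abs_le.1 (h1 I)).2
    have h22 := (abs_le.1 h2).1
    simp only [E]
    linarith
  have hcE : Continuous fun s => dirDeriv 1 W s * dirDeriv 1 W s + dirDeriv I W s * dirDeriv I W s :=
    ((hcont 1).mul (hcont 1)).add ((hcont I).mul (hcont I))
  -- Used for the real and imaginary quadratic terms `W_y² - W_x²` and `2 W_x W_y`, both dominated
  -- by `|∇W|²`.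
  have bound_by_E : ∀ f : ℂ → ℝ, Continuous f → (∀ s, |f s| ≤
      dirDeriv 1 W s * dirDeriv 1 W s + dirDeriv I W s * dirDeriv I W s) →
      |∫ s, f s * χ s| ≤ ε * E := by
    intro f hf h
    refine le_trans (abs_integral_le_integral_abs.trans (integral_mono (hint f hf).abs
      (hint _ hcE) fun s => ?_)) bE
    simp only [abs_mul, abs_of_nonneg (radialBump_nonneg s), hχdef]
    exact mul_le_mul_of_nonneg_right (h s) (radialBump_nonneg s)
  have bQ1 := bound_by_E (fun s => dirDeriv I W s * dirDeriv I W s - dirDeriv 1 W s * dirDeriv 1 W s)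
    (((hcont I).mul (hcont I)).sub ((hcont 1).mul (hcont 1))) fun s => by
      rw [abs_le]; constructor <;> nlinarith [mul_self_nonneg (dirDeriv 1 W s),
        mul_self_nonneg (dirDeriv I W s)]
  have bQ2 := bound_by_E (fun s => 2 * (dirDeriv 1 W s * dirDeriv I W s))
    (((hcont 1).mul (hcont I)).const_mul 2) fun s => by
      rw [abs_le]; constructor <;> nlinarith [mul_self_nonneg (dirDeriv 1 W s - dirDeriv I W s),
        mul_self_nonneg (dirDeriv 1 W s + dirDeriv I W s)]
  set u : ℂ → ℝ := fun s => W s + (2 * l * s.re + c) with hu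
  have e1 : ∀ v, dirDeriv v u = _ := dirDeriv_add_affine hW l c
  have e2 : ∀ v w, dirDeriv w (dirDeriv v u) = _ := dirDeriv_dirDeriv_add_affine hW l c
  -- The shift `4 l²` cancels exactly what the affine part contributes, so every remaining term
  -- contains a derivative of `W`.
  have hre : ∀ s, schwarzRe u s + 4 * l ^ 2 = 2 * dirDeriv 1 (dirDeriv 1 W) s -
      2 * dirDeriv I (dirDeriv I W) s - 4 * l * dirDeriv 1 W s +
      (dirDeriv I W s * dirDeriv I W s - dirDeriv 1 W s * dirDeriv 1 W s) := by
    intro s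
    rw [schwarzRe, e2, e2, e1, e1, one_re, I_re]
    ring
  have him : ∀ s, schwarzIm u s = -4 * dirDeriv I (dirDeriv 1 W) s + 4 * l * dirDeriv I W s +
      2 * (dirDeriv 1 W s * dirDeriv I W s) := by
    intro s
    rw [schwarzIm, e2, e1, e1, one_re, I_re]
    ring
  have hcF : Continuous (schwarzShift l u) := hF.continuous
  have hmean := integral_mul_radialBump hF
  have hsplit : ∫ s, schwarzShift l u s * (χ s : ℂ) =
      ((∫ s, (schwarzRe u s + 4 * l ^ 2) * χ s : ℝ) : ℂ) +
        ((∫ s, schwarzIm u s * χ s : ℝ) : ℂ) * I := by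
    have c1 : Continuous (fun s => schwarzRe u s + 4 * l ^ 2) := by
      have := Complex.continuous_re.comp hcF
      refine this.congr fun s => schwarzShift_re l u s
    have c2 : Continuous (fun s => schwarzIm u s) := by
      have := Complex.continuous_im.comp hcF
      refine this.congr fun s => schwarzShift_im l u s
    rw [← integral_complex_ofReal, ← integral_complex_ofReal, ← integral_mul_const, ← integral_add]
    · congr 1; ext s; simp only [schwarzShift]; push_cast; ring
    · exact (hint _ c1).ofReal
    · exact (hint _ c2).ofReal.mul_const I
  have iA : ∫ s, (schwarzRe u s + 4 * l ^ 2) * χ s = 2 * (∫ s, dirDeriv 1 (dirDeriv 1 W) s * χ s) -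
      2 * (∫ s, dirDeriv I (dirDeriv I W) s * χ s) - 4 * l * (∫ s, dirDeriv 1 W s * χ s) +
      ∫ s, (dirDeriv I W s * dirDeriv I W s - dirDeriv 1 W s * dirDeriv 1 W s) * χ s := by
    rw [← integral_const_mul, ← integral_const_mul, ← integral_const_mul, ← integral_sub,
      ← integral_sub, ← integral_add]
    · congr 1; ext s; rw [hre]; ring
    · exact (((hint _ (hcont2 _ _)).const_mul _).sub ((hint _ (hcont2 _ _)).const_mul _)).sub
        ((hint _ (hcont _)).const_mul _)
    · exact hint _ (((hcont I).mul (hcont I)).sub ((hcont 1).mul (hcont 1)))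
    · exact ((hint _ (hcont2 _ _)).const_mul _).sub ((hint _ (hcont2 _ _)).const_mul _)
    · exact (hint _ (hcont _)).const_mul _
    · exact (hint _ (hcont2 _ _)).const_mul _
    · exact (hint _ (hcont2 _ _)).const_mul _
  have iB : ∫ s, schwarzIm u s * χ s = -4 * (∫ s, dirDeriv I (dirDeriv 1 W) s * χ s) +
      4 * l * (∫ s, dirDeriv I W s * χ s) +
      ∫ s, (2 * (dirDeriv 1 W s * dirDeriv I W s)) * χ s := by
    rw [← integral_const_mul, ← integral_const_mul, ← integral_add, ← integral_add]
    · congr 1; ext s; rw [him]; ring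
    · exact ((hint _ (hcont2 _ _)).const_mul _).add ((hint _ (hcont _)).const_mul _)
    · exact hint _ (((hcont 1).mul (hcont I)).const_mul 2)
    · exact (hint _ (hcont2 _ _)).const_mul _
    · exact (hint _ (hcont _)).const_mul _
  have babs : ∀ a b t : ℝ, |t| ≤ b → |a * t| ≤ |a| * b := fun a b t h => by
    rw [abs_mul]; exact mul_le_mul_of_nonneg_left h (abs_nonneg _)
  have bA : |∫ s, (schwarzRe u s + 4 * l ^ 2) * χ s| ≤ 2 * (ε * N (dirDeriv 1 (dirDeriv 1 χ))) +
      2 * (ε * N (dirDeriv I (dirDeriv I χ))) + 4 * |l| * (ε * N (dirDeriv 1 χ)) + ε * E := by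
    rw [iA]
    have t1 := babs 2 _ _ (b2 1 1)
    have t2 := babs 2 _ _ (b2 I I)
    have t3 := babs (4 * l) _ _ (b1 1)
    rw [abs_two] at t1 t2
    rw [abs_mul 4 l, abs_of_pos (by norm_num : (0 : ℝ) < 4)] at t3
    exact (abs_add_le _ _).trans (add_le_add ((abs_sub _ _).trans (add_le_add
      ((abs_sub _ _).trans (add_le_add t1 t2)) t3)) bQ1)
  have bB : |∫ s, schwarzIm u s * χ s| ≤ 4 * (ε * N (dirDeriv 1 (dirDeriv I χ))) +
      4 * |l| * (ε * N (dirDeriv I χ)) + ε * E := by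
    rw [iB]
    have t1 := babs (-4) _ _ (b2 I 1)
    have t3 := babs (4 * l) _ _ (b1 I)
    rw [abs_neg, abs_of_pos (by norm_num : (0 : ℝ) < 4)] at t1
    rw [abs_mul 4 l, abs_of_pos (by norm_num : (0 : ℝ) < 4)] at t3
    exact (abs_add_le _ _).trans (add_le_add ((abs_add_le _ _).trans (add_le_add t1 t3)) bQ2)
  rw [div_mul_eq_mul_div, le_div_iff₀ hm]
  have hnorm : ‖schwarzShift l u 0‖ * ∫ s, χ s =
      ‖∫ s, schwarzShift l u s * (χ s : ℂ)‖ := by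
    rw [hmean, norm_mul, norm_real, Real.norm_eq_abs, abs_of_pos hm]
  rw [hnorm, hsplit]
  refine (norm_add_le _ _).trans ?_
  rw [norm_mul, norm_I, mul_one, norm_real, norm_real, Real.norm_eq_abs, Real.norm_eq_abs]
  refine (add_le_add bA bB).trans (le_of_eq ?_)
  simp only [T]
  ring

theorem lap_comp_add (u : ℂ → ℝ) (a s : ℂ) : lap (fun s => u (s + a)) s = lap u (s + a) := by
  simp only [lap, dirDeriv_comp_add]

theorem schwarzShift_comp_add (l : ℝ) (u : ℂ → ℝ) (a s : ℂ) :
    schwarzShift l (fun s => u (s + a)) s = schwarzShift l u (s + a) := by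
  simp only [schwarzShift, schwarzRe, schwarzIm, dirDeriv_comp_add]

/-- On unit discs far out, `u` is uniformly close to an affine function, and its Laplacian `-2 e^u`
is small because `hl` forces `u → -∞`; the interior estimate applies at each centre. Condition `hf`
says that the filter tolerates shifts by at most one, which lets one proof serve both ends. -/
theorem tendsto_schwarzShift {u : ℂ → ℝ} (hu : ContDiff ℝ (⊤ : ℕ∞) u)
    (hL : ∀ s, lap u s = -2 * Real.exp (u s)) {l L : ℝ} {f : Filter ℝ}
    (hf : ∀ q : ℝ → Prop, (∀ᶠ x in f, q x) → ∀ᶠ x in f, ∀ y, |y - x| ≤ 1 → q y)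
    (hl : Tendsto (fun x : ℝ => 2 * l * x) f atBot)
    (h : Tendsto (fun s : ℂ => u s - 2 * l * s.re) (comap Complex.re f) (𝓝 L)) :
    Tendsto (schwarzShift l u) (comap Complex.re f) (𝓝 0) := by
  obtain ⟨C, hC0, hC⟩ := exists_norm_schwarzShift_le l
  have hexp : Tendsto (fun s : ℂ => 2 * Real.exp (u s)) (comap Complex.re f) (𝓝 0) := by
    have h1 : Tendsto (fun s : ℂ => (u s - 2 * l * s.re) + 2 * l * s.re) (comap Complex.re f)
        atBot := h.add_atBot (hl.comp tendsto_comap)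
    simpa using (Real.tendsto_exp_atBot.comp (h1.congr fun s => by ring)).const_mul 2
  rw [Metric.tendsto_nhds]
  intro δ hδ
  obtain ⟨ε, hε0, hε1, hεδ⟩ : ∃ ε : ℝ, 0 < ε ∧ ε ≤ 1 ∧ C * ε < δ := by
    -- `C + 1` rather than `C`, since `C` may vanish.
    refine ⟨min 1 (δ / (C + 1)), by positivity, min_le_left _ _, ?_⟩
    calc C * min 1 (δ / (C + 1)) ≤ C * (δ / (C + 1)) :=
          mul_le_mul_of_nonneg_left (min_le_right _ _) hC0
      _ < δ := by
          rw [mul_div_assoc', div_lt_iff₀ (by positivity)]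
          nlinarith
  have e1 := (Metric.tendsto_nhds.1 h) ε hε0
  have e2 := (Metric.tendsto_nhds.1 hexp) ε hε0
  have e3 := e1.and e2
  rw [eventually_comap] at e3 ⊢
  filter_upwards [hf _ e3] with x hx s hs
  subst hs
  have hb : ∀ t ∈ Metric.closedBall (0 : ℂ) 1,
      |u (t + s) - 2 * l * (t + s).re - L| ≤ ε ∧ |2 * Real.exp (u (t + s))| ≤ ε := by
    intro t ht
    have : |(t + s).re - s.re| ≤ 1 := by
      simpa using (Complex.abs_re_le_norm t).trans (mem_closedBall_zero_iff.1 ht)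
    have h' := hx _ this (t + s) rfl
    rw [Real.dist_eq, Real.dist_eq, sub_zero] at h'
    exact ⟨h'.1.le, h'.2.le⟩
  let W : ℂ → ℝ := fun t => u (t + s) - 2 * l * (t + s).re - L
  have hre : ContDiff ℝ (⊤ : ℕ∞) (fun t : ℂ => t.re) := Complex.reCLM.contDiff
  have hW : ContDiff ℝ (⊤ : ℕ∞) W := by
    have h1 : ContDiff ℝ (⊤ : ℕ∞) (fun t => u (t + s)) := hu.comp (contDiff_id.add contDiff_const)
    have h2 : ContDiff ℝ (⊤ : ℕ∞) (fun t : ℂ => (t + s).re) :=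
      hre.comp (contDiff_id.add contDiff_const)
    exact (h1.sub (contDiff_const.mul h2)).sub contDiff_const
  have hWu : (fun t => W t + (2 * l * t.re + (2 * l * s.re + L))) = fun t => u (t + s) := by
    ext t; simp only [W, Complex.add_re]; ring
  have hlapW : ∀ t, lap W t = -2 * Real.exp (u (t + s)) := by
    intro t
    rw [← lap_add_affine hW l (2 * l * s.re + L), hWu, lap_comp_add, hL]
  have key := hC W (2 * l * s.re + L) ε hW hε1 (fun t ht => (hb t ht).1)
    (fun t ht => by rw [hlapW, neg_mul, abs_neg]; exact (hb t ht).2) (by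
      rw [hWu]
      refine differentiable_schwarz (hu.comp (contDiff_id.add contDiff_const)) (fun t => ?_) _
      exact (lap_comp_add u s t).trans (hL _))
  rw [hWu, schwarzShift_comp_add, zero_add] at key
  rw [dist_zero_right]
  exact key.trans_lt hεδ

/-! ### Constancy of the Schwarzian by Liouville's theorem -/

/-- A periodic solution of the Liouville equation with the asymptotics of two conical points of angle
`2πα` at the ends of the cylinder satisfies `u_ss - u_s ^ 2 / 2 = - α ^ 2 / 2`. -/
theorem schwarzShift_eq_zero {u : ℂ → ℝ} (hu : ContDiff ℝ (⊤ : ℕ∞) u)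
    (hL : ∀ s, lap u s = -2 * Real.exp (u s))
    (hper : ∀ s, u (s + 2 * Real.pi * Complex.I) = u s) {α L L' : ℝ} (hα : 0 < α)
    (hbot : Tendsto (fun s : ℂ => u s - 2 * α * s.re) (comap Complex.re atBot) (𝓝 L))
    (htop : Tendsto (fun s : ℂ => u s + 2 * α * s.re) (comap Complex.re atTop) (𝓝 L')) (s : ℂ) :
    schwarzShift α u s = 0 := by
  have t1 : Tendsto (schwarzShift α u) (comap Complex.re atBot) (𝓝 0) := by
    refine tendsto_schwarzShift hu hL (fun q hq => ?_) ?_ hbot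
    · obtain ⟨a, ha⟩ := eventually_atBot.1 hq
      filter_upwards [eventually_le_atBot (a - 1)] with x hx y hy
      exact ha y (by linarith [(abs_le.1 hy).2])
    · exact tendsto_id.const_mul_atBot (by positivity)
  have t2 : Tendsto (schwarzShift α u) (comap Complex.re atTop) (𝓝 0) := by
    -- The slopes at the two ends are opposite, but the limit depends only on the square of the
    -- slope.
    have : schwarzShift α u = schwarzShift (-α) u := by
      ext s; simp only [schwarzShift, neg_sq]
    rw [this]
    refine tendsto_schwarzShift hu hL (L := L') (fun q hq => ?_) ?_ ?_
    · obtain ⟨a, ha⟩ := eventually_atTop.1 hq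
      filter_upwards [eventually_ge_atTop (a + 1)] with x hx y hy
      exact ha y (by linarith [(abs_le.1 hy).1])
    · exact tendsto_id.const_mul_atTop_of_neg (by linarith)
    · exact htop.congr fun s => by ring
  have hd : Differentiable ℂ (schwarzShift α u) := differentiable_schwarz hu hL _
  have hperF : Function.Periodic (schwarzShift α u) (2 * Real.pi * Complex.I) := by
    intro s
    rw [← schwarzShift_comp_add, funext hper]
  obtain ⟨a, ha⟩ := eventually_atBot.1 (eventually_comap.1 ((Metric.tendsto_nhds.1 t1) 1 one_pos))
  obtain ⟨b, hb⟩ := eventually_atTop.1 (eventually_comap.1 ((Metric.tendsto_nhds.1 t2) 1 one_pos))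
  have hK : IsCompact (Icc a b ×ℂ Icc 0 (2 * Real.pi)) := isCompact_Icc.reProdIm isCompact_Icc
  obtain ⟨M, hM⟩ := hK.exists_bound_of_continuousOn hd.continuous.continuousOn
  have hbdd : Bornology.IsBounded (range (schwarzShift α u)) := by
    refine isBounded_iff_forall_norm_le.2 ⟨max M 1, ?_⟩
    rintro _ ⟨s, rfl⟩
    rcases le_total s.re a with h | h
    · have := ha _ h s rfl
      rw [dist_zero_right] at this
      exact this.le.trans (le_max_right _ _)
    rcases le_total b s.re with h' | h'
    · have := hb _ h' s rfl
      rw [dist_zero_right] at this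
      exact this.le.trans (le_max_right _ _)
    -- Between the two ends a translation by periods brings the point into the compact rectangle.
    obtain ⟨n, hn, -⟩ := existsUnique_sub_zsmul_mem_Ico Real.two_pi_pos s.im 0
    rw [← hperF.sub_zsmul_eq n]
    refine (hM _ ?_).trans (le_max_left _ _)
    rw [Complex.mem_reProdIm]
    simp only [zsmul_eq_mul, zero_add] at hn ⊢
    constructor
    · simpa using ⟨h, h'⟩
    · simpa using Ico_subset_Icc_self hn
  have hconst : ∀ t, schwarzShift α u t = schwarzShift α u s :=
    fun t => hd.apply_eq_apply_of_bounded hbdd t s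
  have : (comap Complex.re atBot).NeBot :=
    comap_neBot_iff_frequently.2 (Frequently.of_forall fun x => ⟨(x : ℂ), Complex.ofReal_re x⟩)
  exact tendsto_nhds_unique (tendsto_const_nhds.congr fun t => (hconst t).symm) t1

/-! ### Linearization and explicit solutions -/

theorem eq_of_dirDeriv_eq_zero {h : ℂ → ℝ} (hh : ContDiff ℝ (⊤ : ℕ∞) h)
    (h1 : ∀ s, dirDeriv 1 h s = 0) (h2 : ∀ s, dirDeriv Complex.I h s = 0) (s t : ℂ) : h s = h t := by
  refine is_const_of_fderiv_eq_zero (hh.differentiable (by simp)) (fun x => ?_) s t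
  ext v
  have := dirDeriv_eq_combination (f := h) v x
  rw [h1, h2] at this
  simpa [dirDeriv] using this

/-- For `β = ±α` the function `(p_x + β p) e^{-βx}` has zero gradient. The two constants so obtained
determine `p` by subtraction. -/
theorem eq_exp_of_dirDeriv {α : ℝ} (hα : α ≠ 0) {p : ℂ → ℝ} (hp : ContDiff ℝ (⊤ : ℕ∞) p)
    (hI : ∀ s, dirDeriv Complex.I p s = 0)
    (h1 : ∀ s, dirDeriv 1 (dirDeriv 1 p) s = α ^ 2 * p s) (s : ℂ) :
    p s = (p 0 + dirDeriv 1 p 0 / α) / 2 * Real.exp (α * s.re) +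
      (p 0 - dirDeriv 1 p 0 / α) / 2 * Real.exp (-(α * s.re)) := by
  have hI' : ∀ s, dirDeriv Complex.I (dirDeriv 1 p) s = 0 := by
    intro s
    rw [dirDeriv_comm _ _ hp, funext hI, dirDeriv_const]
  have key : ∀ β : ℝ, β ^ 2 = α ^ 2 →
      (dirDeriv 1 p s + β * p s) * Real.exp (-β * s.re) = dirDeriv 1 p 0 + β * p 0 := by
    intro β hβ
    have hre : ContDiff ℝ (⊤ : ℕ∞) (fun s : ℂ => s.re) := Complex.reCLM.contDiff
    have hmul : ContDiff ℝ (⊤ : ℕ∞) (fun s : ℂ => -β * s.re) := contDiff_const.mul hre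
    have hd : ∀ v s, dirDeriv v (fun s => (dirDeriv 1 p s + β * p s) * Real.exp (-β * s.re)) s =
        (dirDeriv 1 p s + β * p s) * (Real.exp (-β * s.re) * (-β * v.re)) +
        Real.exp (-β * s.re) * (dirDeriv v (dirDeriv 1 p) s + β * dirDeriv v p s) := by
      intro v s
      rw [dirDeriv_mul v (by fun_prop) (by fun_prop), dirDeriv_exp v hmul,
        dirDeriv_const_mul v _ hre, dirDeriv_re, dirDeriv_add v (by fun_prop) (by fun_prop),
        dirDeriv_const_mul v _ hp]
    have := eq_of_dirDeriv_eq_zero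
      (h := fun s => (dirDeriv 1 p s + β * p s) * Real.exp (-β * s.re)) (by fun_prop)
      (fun s => by
        rw [hd, h1, ← hβ]
        simp only [Complex.one_re]
        ring)
      (fun s => by rw [hd, hI, hI']; simp) s 0
    simpa using this
  have k1 := key α rfl
  have k2 := key (-α) (by ring)
  rw [neg_mul, Real.exp_neg] at k1
  rw [neg_neg] at k2
  rw [Real.exp_neg]
  have hE := Real.exp_pos (α * s.re)
  set E := Real.exp (α * s.re)
  have k1' : dirDeriv 1 p s + α * p s = (dirDeriv 1 p 0 + α * p 0) * E := by
    rw [← k1]; field_simp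
  have k2' : dirDeriv 1 p s + -α * p s = (dirDeriv 1 p 0 + -α * p 0) * E⁻¹ := by
    rw [← k2]; field_simp
  have : p s = (1 / (2 * α)) * ((dirDeriv 1 p s + α * p s) - (dirDeriv 1 p s + -α * p s)) := by
    field_simp; ring
  rw [this, k1', k2']
  field_simp; ring

/-- The vector `(α q, q_y)` rotates with angle `αy`, so rotating it back gives the two first
integrals `k1` and `k2`. -/
theorem eq_cos_sin_of_dirDeriv {α : ℝ} (hα : α ≠ 0) {q : ℂ → ℝ} (hq : ContDiff ℝ (⊤ : ℕ∞) q)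
    (h1 : ∀ s, dirDeriv 1 q s = 0)
    (hI : ∀ s, dirDeriv Complex.I (dirDeriv Complex.I q) s = -α ^ 2 * q s) (s : ℂ) :
    q s = q 0 * Real.cos (α * s.im) + dirDeriv Complex.I q 0 / α * Real.sin (α * s.im) := by
  have h1' : ∀ s, dirDeriv 1 (dirDeriv Complex.I q) s = 0 := by
    intro s
    rw [dirDeriv_comm _ _ hq, funext h1, dirDeriv_const]
  have him : ContDiff ℝ (⊤ : ℕ∞) (fun s : ℂ => s.im) := Complex.imCLM.contDiff
  have hmul : ContDiff ℝ (⊤ : ℕ∞) (fun s : ℂ => α * s.im) := contDiff_const.mul him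
  have hcos : ContDiff ℝ (⊤ : ℕ∞) (fun s : ℂ => Real.cos (α * s.im)) := hmul.cos
  have hsin : ContDiff ℝ (⊤ : ℕ∞) (fun s : ℂ => Real.sin (α * s.im)) := hmul.sin
  have dmul : ∀ v s, fderiv ℝ (fun s : ℂ => α * s.im) s v = α * v.im := fun v s => by
    have := congrFun (dirDeriv_const_mul v α him) s
    rwa [dirDeriv_im] at this
  have dcos : ∀ v s, dirDeriv v (fun s : ℂ => Real.cos (α * s.im)) s =
      -Real.sin (α * s.im) * (α * v.im) := fun v s => by
    simp [dirDeriv, fderiv_cos (hmul.diffAt s), dmul]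
  have dsin : ∀ v s, dirDeriv v (fun s : ℂ => Real.sin (α * s.im)) s =
      Real.cos (α * s.im) * (α * v.im) := fun v s => by
    simp [dirDeriv, fderiv_sin (hmul.diffAt s), dmul]
  have k1 : α * q s * Real.cos (α * s.im) - dirDeriv Complex.I q s * Real.sin (α * s.im) =
      α * q 0 := by
    have hd : ∀ v s, dirDeriv v (fun s => α * q s * Real.cos (α * s.im) -
        dirDeriv Complex.I q s * Real.sin (α * s.im)) s =
        α * q s * (-Real.sin (α * s.im) * (α * v.im)) + Real.cos (α * s.im) * (α * dirDeriv v q s) -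
        (dirDeriv Complex.I q s * (Real.cos (α * s.im) * (α * v.im)) +
          Real.sin (α * s.im) * dirDeriv v (dirDeriv Complex.I q) s) := by
      intro v s
      rw [dirDeriv_sub v (by fun_prop) (by fun_prop),
        dirDeriv_mul v (f := fun s => α * q s) (by fun_prop) hcos,
        dirDeriv_mul v (f := dirDeriv Complex.I q) (by fun_prop) (by fun_prop),
        dirDeriv_const_mul v _ hq]
      simp only [dcos, dsin]
    have := eq_of_dirDeriv_eq_zero (h := fun s => α * q s * Real.cos (α * s.im) -
        dirDeriv Complex.I q s * Real.sin (α * s.im)) (by fun_prop)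
      (fun s => by rw [hd, h1, h1']; simp)
      (fun s => by rw [hd, hI]; simp only [Complex.I_im]; ring) s 0
    simpa using this
  have k2 : α * q s * Real.sin (α * s.im) + dirDeriv Complex.I q s * Real.cos (α * s.im) =
      dirDeriv Complex.I q 0 := by
    have hd : ∀ v s, dirDeriv v (fun s => α * q s * Real.sin (α * s.im) +
        dirDeriv Complex.I q s * Real.cos (α * s.im)) s =
        α * q s * (Real.cos (α * s.im) * (α * v.im)) + Real.sin (α * s.im) * (α * dirDeriv v q s) +
        (dirDeriv Complex.I q s * (-Real.sin (α * s.im) * (α * v.im)) +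
          Real.cos (α * s.im) * dirDeriv v (dirDeriv Complex.I q) s) := by
      intro v s
      rw [dirDeriv_add v (by fun_prop) (by fun_prop),
        dirDeriv_mul v (f := fun s => α * q s) (by fun_prop) hsin,
        dirDeriv_mul v (f := dirDeriv Complex.I q) (by fun_prop) (by fun_prop),
        dirDeriv_const_mul v _ hq]
      simp only [dcos, dsin]
    have := eq_of_dirDeriv_eq_zero (h := fun s => α * q s * Real.sin (α * s.im) +
        dirDeriv Complex.I q s * Real.cos (α * s.im)) (by fun_prop)
      (fun s => by rw [hd, h1, h1']; simp)
      (fun s => by rw [hd, hI]; simp only [Complex.I_im]; ring) s 0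
    simpa using this
  have hcs := Real.sin_sq_add_cos_sq (α * s.im)
  have : α * q s = α * q 0 * Real.cos (α * s.im) +
      dirDeriv Complex.I q 0 * Real.sin (α * s.im) := by
    rw [← k1, ← k2]
    linear_combination (-(α * q s)) * hcs
  field_simp
  linear_combination this

open Complex in
/-- The solutions of the Liouville equation with constant `u_ss - u_s ^ 2 / 2 = - α ^ 2 / 2`. -/
theorem exists_exp_neg_half_eq {u : ℂ → ℝ} (hu : ContDiff ℝ (⊤ : ℕ∞) u)
    (hL : ∀ s, lap u s = -2 * Real.exp (u s)) {α : ℝ} (hα : α ≠ 0)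
    (hS : ∀ s, schwarzShift α u s = 0) :
    ∃ a b c d : ℝ, 0 < a ∧ 0 < b ∧ α ^ 2 * (4 * a * b - c ^ 2 - d ^ 2) = 1 ∧
      ∀ s : ℂ, Real.exp (-(1 / 2) * u s) = a * Real.exp (α * s.re) + b * Real.exp (-(α * s.re)) +
        c * Real.cos (α * s.im) + d * Real.sin (α * s.im) := by
  have hR : ∀ s, schwarzRe u s + 4 * α ^ 2 = 0 := fun s => by
    rw [← schwarzShift_re, hS, zero_re]
  have hI : ∀ s, schwarzIm u s = 0 := fun s => by
    rw [← schwarzShift_im α, hS, zero_im]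
  set V : ℂ → ℝ := fun s => Real.exp (-(1 / 2) * u s) with hVdef
  have hV : ContDiff ℝ (⊤ : ℕ∞) V := by fun_prop
  have hV1 : ∀ v, dirDeriv v V = fun s => V s * (-(1 / 2) * dirDeriv v u s) := by
    intro v
    rw [hVdef, dirDeriv_exp v (by fun_prop), dirDeriv_const_mul v _ hu]
  have hV2 : ∀ v w, dirDeriv w (dirDeriv v V) = fun s =>
      V s * (-(1 / 2) * dirDeriv w (dirDeriv v u) s + (1 / 4) * (dirDeriv w u s * dirDeriv v u s)) := by
    intro v w
    rw [hV1, dirDeriv_mul w hV (by fun_prop), dirDeriv_const_mul w _ (by fun_prop), hV1]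
    ext s; ring
  have hxy : ∀ s, dirDeriv I (dirDeriv 1 V) s = 0 := by
    intro s
    have := hI s
    simp only [schwarzIm] at this
    simp only [hV2]
    linear_combination (V s / 8) * this
  have hdiff : ∀ s, dirDeriv 1 (dirDeriv 1 V) s - dirDeriv I (dirDeriv I V) s = α ^ 2 * V s := by
    intro s
    have := hR s
    simp only [schwarzRe] at this
    simp only [hV2]
    linear_combination (-V s / 4) * this
  -- This is the Liouville equation rewritten for `V`, using `V² e^u = 1`; at `s = 0` it yields the
  -- relation between the coefficients.
  have hquad : ∀ s, V s * (dirDeriv 1 (dirDeriv 1 V) s + dirDeriv I (dirDeriv I V) s) -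
      dirDeriv 1 V s ^ 2 - dirDeriv I V s ^ 2 = 1 := by
    intro s
    have h1 := hL s
    simp only [lap] at h1
    have h2 : V s ^ 2 * Real.exp (u s) = 1 := by
      rw [hVdef, ← Real.exp_nat_mul, ← Real.exp_add]
      simp
    rw [hV2, hV2, hV1, hV1]
    linear_combination (-V s ^ 2 / 2) * h1 + h2
  have hα2 : α ^ 2 ≠ 0 := pow_ne_zero 2 hα
  have hyx : ∀ s, dirDeriv 1 (dirDeriv I V) s = 0 := fun s => by
    rw [dirDeriv_comm _ _ hV, hxy]
  have dI11 : dirDeriv I (dirDeriv 1 (dirDeriv 1 V)) = fun _ => 0 := by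
    rw [dirDeriv_comm _ _ (by fun_prop), funext hxy, dirDeriv_const]
  have d1II : dirDeriv 1 (dirDeriv I (dirDeriv I V)) = fun _ => 0 := by
    rw [dirDeriv_comm _ _ (by fun_prop), funext hyx, dirDeriv_const]
  have h11 : dirDeriv 1 (dirDeriv 1 V) = fun s => dirDeriv I (dirDeriv I V) s + α ^ 2 * V s := by
    ext s; linarith [hdiff s]
  have hII : dirDeriv I (dirDeriv I V) = fun s => dirDeriv 1 (dirDeriv 1 V) s - α ^ 2 * V s := by
    ext s; linarith [hdiff s]
  have d111 : dirDeriv 1 (dirDeriv 1 (dirDeriv 1 V)) = fun s => α ^ 2 * dirDeriv 1 V s := by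
    conv_lhs => rw [h11]
    rw [dirDeriv_add _ (by fun_prop) (by fun_prop), d1II, dirDeriv_const_mul _ _ hV]
    simp
  have dIII : dirDeriv I (dirDeriv I (dirDeriv I V)) = fun s => -α ^ 2 * dirDeriv I V s := by
    conv_lhs => rw [hII]
    rw [dirDeriv_sub _ (by fun_prop) (by fun_prop), dI11, dirDeriv_const_mul _ _ hV]
    simp
  -- Since `V_xy = 0`, `p` depends on `x` only and `q` on `y` only; each solves its own ordinary
  -- equation, and `V = (p - q) / α²`.
  set p : ℂ → ℝ := dirDeriv 1 (dirDeriv 1 V) with hp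
  set q : ℂ → ℝ := dirDeriv I (dirDeriv I V) with hq
  have hpe := eq_exp_of_dirDeriv hα (p := p) (by fun_prop) (fun s => by rw [dI11]) (fun s => by
    rw [d111, dirDeriv_const_mul _ _ (by fun_prop)])
  have hqe := eq_cos_sin_of_dirDeriv hα (q := q) (by fun_prop) (fun s => by rw [d1II]) (fun s => by
    rw [dIII, dirDeriv_const_mul _ _ (by fun_prop)])
  have hp1 : dirDeriv 1 p 0 = α ^ 2 * dirDeriv 1 V 0 := by rw [d111]
  have hq1 : dirDeriv I q 0 = -α ^ 2 * dirDeriv I V 0 := by rw [dIII]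
  have hq0 := hquad 0
  have hV0 := hdiff 0
  have hV0pos : 0 < V 0 := Real.exp_pos _
  obtain ⟨a, ha⟩ : ∃ a, a = (p 0 + dirDeriv 1 p 0 / α) / 2 / α ^ 2 := ⟨_, rfl⟩
  obtain ⟨b, hb⟩ : ∃ b, b = (p 0 - dirDeriv 1 p 0 / α) / 2 / α ^ 2 := ⟨_, rfl⟩
  obtain ⟨c, hc⟩ : ∃ c, c = -q 0 / α ^ 2 := ⟨_, rfl⟩
  obtain ⟨d, hd⟩ : ∃ d, d = -(dirDeriv I q 0 / α) / α ^ 2 := ⟨_, rfl⟩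
  have hrel : α ^ 2 * (4 * a * b - c ^ 2 - d ^ 2) = 1 := by
    rw [← hq0, ha, hb, hc, hd, hp1, hq1]
    have : V 0 = (p 0 - q 0) / α ^ 2 := by rw [hV0]; field_simp
    rw [this]
    field_simp
    ring
  have hsum : a + b + c = V 0 := by
    have : V 0 = (p 0 - q 0) / α ^ 2 := by rw [hV0]; field_simp
    rw [this, ha, hb, hc]
    field_simp
    ring
  have hab : c ^ 2 < 4 * (a * b) := by
    have : 0 < α ^ 2 := by positivity
    have h1 : 0 < 4 * a * b - c ^ 2 - d ^ 2 := by
      by_contra! h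
      nlinarith
    nlinarith [sq_nonneg d]
  have hab0 : 0 < a * b := by nlinarith [sq_nonneg c]
  -- If both were negative, `a + b + c = V 0 > 0` would give `c² > (a + b)² ≥ 4ab`, against `hab`.
  have hpos : 0 < a ∧ 0 < b := by
    rcases pos_and_pos_or_neg_and_neg_of_mul_pos hab0 with h | ⟨h1, h2⟩
    · exact h
    · exfalso
      nlinarith [sq_nonneg (a - b)]
  refine ⟨a, b, c, d, hpos.1, hpos.2, hrel, fun s => ?_⟩
  have hVs : V s = (p s - q s) / α ^ 2 := by rw [hdiff s]; field_simp
  rw [show Real.exp (-(1 / 2) * u s) = V s from rfl, hVs, hpe s, hqe s, ha, hb, hc, hd]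
  field_simp
  ring

/-! ### Passage to the coordinate `log z` -/

open Complex in
/-- The Laplacian in the coordinate `log z`. -/
theorem lap_comp_exp {r : ℂ → ℝ} (hr : ContDiffOn ℝ (⊤ : ℕ∞) r {0}ᶜ) (s : ℂ) :
    lap (fun t => r (exp t)) s = Complex.normSq (exp s) * Laplacian.laplacian r (exp s) := by
  have hat : ∀ t, ContDiffAt ℝ (⊤ : ℕ∞) r (exp t) := fun t =>
    hr.contDiffAt (isOpen_compl_singleton.mem_nhds (exp_ne_zero t))
  have hexp : ∀ t, HasFDerivAt exp (exp t • (1 : ℂ →L[ℝ] ℂ)) t := fun t =>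
    (hasStrictFDerivAt_exp_real t).hasFDerivAt
  have h1 : ∀ v, dirDeriv v (fun t => r (exp t)) = fun t => fderiv ℝ r (exp t) (exp t * v) := by
    intro v; ext t
    have : HasFDerivAt (fun t => r (exp t)) _ t :=
      (((hat t).differentiableAt (by simp)).hasFDerivAt).comp t (hexp t)
    simp [dirDeriv, this.fderiv]
  have h2 : ∀ v, dirDeriv v (dirDeriv v (fun t => r (exp t))) s =
      fderiv ℝ (fderiv ℝ r) (exp s) (exp s * v) (exp s * v) +
        fderiv ℝ r (exp s) (exp s * v * v) := by
    intro v
    rw [h1]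
    have hd : DifferentiableAt ℝ (fderiv ℝ r) (exp s) :=
      ((hat s).fderiv_right (m := (⊤ : ℕ∞)) (by simp)).differentiableAt (by simp)
    have ha : HasFDerivAt (fun t => fderiv ℝ r (exp t)) _ s := hd.hasFDerivAt.comp s (hexp s)
    have hb : HasFDerivAt (fun t => exp t * v) _ s := (hexp s).mul_const' v
    have := ha.clm_apply hb
    simp [dirDeriv, this.fderiv, add_comm, mul_comm v]
  rw [lap, h2, h2, InnerProductSpace.laplacian_eq_iteratedFDeriv_complexPlane]
  simp only [iteratedFDeriv_two_apply, Matrix.cons_val_zero, Matrix.cons_val_one]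
  obtain ⟨x, y, hxy⟩ : ∃ x y : ℝ, exp s = x • (1 : ℂ) + y • I :=
    ⟨(exp s).re, (exp s).im, by simp [re_add_im]⟩
  have e1 : exp s * 1 = x • (1 : ℂ) + y • I := by rw [mul_one, hxy]
  have e2 : exp s * I = (-y) • (1 : ℂ) + x • I := by
    rw [hxy]
    simp only [real_smul, ofReal_neg]
    linear_combination (y : ℂ) * I_mul_I
  -- The first-order terms in the two directions are opposite and cancel, because `exp` is
  -- holomorphic.
  have e3 : exp s * 1 * 1 = exp s := by ring
  have e4 : exp s * I * I = - exp s := by linear_combination exp s * I_mul_I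
  have e5 : Complex.normSq (exp s) = x * x + y * y := by
    rw [hxy]
    simp [Complex.normSq_apply]
  rw [e3, e4, e1, e2, e5, map_neg]
  generalize fderiv ℝ (fderiv ℝ r) (exp s) = B
  simp only [map_add, map_smul, add_apply, smul_apply,
    smul_eq_mul]
  ring

/-- The logarithm of the density of a conformal metric on `ℂ ∖ {0}` in the coordinate `log z`. -/
noncomputable def ConformalMetric.logDensity (g : ConformalMetric ({0}ᶜ : Set ℂ)) (s : ℂ) : ℝ :=
  Real.log (g.density (Complex.exp s)) + (2 * 1 * s.re + 0)

namespace ConformalMetric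

variable (g : ConformalMetric ({0}ᶜ : Set ℂ))

theorem contDiffOn_log_density :
    ContDiffOn ℝ (⊤ : ℕ∞) (fun z => Real.log (g.density z)) {0}ᶜ :=
  g.smooth.log fun z hz => (g.pos z hz).ne'

theorem contDiff_log_density_exp :
    ContDiff ℝ (⊤ : ℕ∞) (fun s => Real.log (g.density (Complex.exp s))) :=
  g.contDiffOn_log_density.comp_contDiff (f := Complex.exp) Complex.contDiff_exp
    fun s => Complex.exp_ne_zero s

theorem contDiff_logDensity : ContDiff ℝ (⊤ : ℕ∞) g.logDensity := by
  have hre : ContDiff ℝ (⊤ : ℕ∞) (fun t : ℂ => t.re) := Complex.reCLM.contDiff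
  exact g.contDiff_log_density_exp.add (by fun_prop)

theorem exp_logDensity (s : ℂ) :
    Real.exp (g.logDensity s) = Complex.normSq (Complex.exp s) * g.density (Complex.exp s) := by
  rw [logDensity, Real.exp_add, Real.exp_log (g.pos _ (Complex.exp_ne_zero s)),
    Complex.normSq_eq_norm_sq, Complex.norm_exp, ← Real.exp_nat_mul, mul_comm]
  congr 2
  push_cast; ring

theorem lap_logDensity (hK : ∀ z : ℂ, z ≠ 0 → g.gaussCurvature z = 1) (s : ℂ) :
    lap g.logDensity s = -2 * Real.exp (g.logDensity s) := by
  have h := hK _ (Complex.exp_ne_zero s)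
  have hp := g.pos _ (Complex.exp_ne_zero s)
  rw [gaussCurvature, div_eq_one_iff_eq (by positivity)] at h
  -- The summand `2 * 1 * s.re + 0` in `logDensity` has the shape of the affine lemma with `l = 1`,
  -- `c = 0`, so it matches definitionally.
  have h' : lap g.logDensity s = lap (fun s => Real.log (g.density (Complex.exp s))) s :=
    lap_add_affine g.contDiff_log_density_exp 1 0 s
  rw [h', lap_comp_exp g.contDiffOn_log_density, exp_logDensity]
  linear_combination (-Complex.normSq (Complex.exp s)) * h

theorem logDensity_periodic (s : ℂ) :
    g.logDensity (s + 2 * Real.pi * Complex.I) = g.logDensity s := by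
  simp [logDensity, Complex.exp_periodic s]

end ConformalMetric

/-! ### Cone asymptotics in the standard coordinates -/

/-- The derivative of an injective holomorphic function does not vanish. -/
theorem deriv_ne_zero_of_injOn {f : ℂ → ℂ} {N : Set ℂ} (hN : N ∈ 𝓝 (0 : ℂ)) (hf : AnalyticAt ℂ f 0)
    (hinj : InjOn f N) (h0 : f 0 = 0) : deriv f 0 ≠ 0 := by
  have hnz : ¬ ∀ᶠ z in 𝓝 (0 : ℂ), f z = 0 := by
    intro h
    have h1 : ∀ᶠ z in 𝓝[≠] (0 : ℂ), f z = 0 ∧ z ∈ N ∧ z ≠ 0 :=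
      (h.filter_mono nhdsWithin_le_nhds).and
        (Filter.Eventually.and (mem_nhdsWithin_of_mem_nhds hN) self_mem_nhdsWithin)
    obtain ⟨z, hz, hzN, hz0⟩ := h1.exists
    exact hz0 (hinj hzN (mem_of_mem_nhds hN) (hz.trans h0.symm))
  obtain ⟨n, g, hg, hg0, hfg⟩ := hf.exists_eventuallyEq_pow_smul_nonzero_iff.2 hnz
  simp only [sub_zero, smul_eq_mul] at hfg
  have hn0 : n ≠ 0 := by
    rintro rfl
    have := hfg.self_of_nhds
    rw [h0, pow_zero, one_mul] at this
    exact hg0 this.symm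
  rcases eq_or_ne n 1 with rfl | hn1
  · have hd : HasDerivAt (fun z => z ^ 1 * g z) (1 * g 0 + 0 * deriv g 0) 0 := by
      simp only [pow_one]
      exact (hasDerivAt_id (0 : ℂ)).mul hg.differentiableAt.hasDerivAt
    rw [(EventuallyEq.deriv_eq hfg), hd.deriv]
    simpa using hg0
  exfalso
  -- For a zero of order `n ≥ 2`, `k` is a local coordinate with `f = g(0) k^n`. Division by `g 0`
  -- keeps the logarithm near `1`, inside its principal branch. Two points whose `k`-values differ
  -- by a primitive `n`-th root of unity then contradict injectivity.
  let k : ℂ → ℂ := fun z => z * Complex.exp (Complex.log (g z / g 0) / n)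
  have hE : AnalyticAt ℂ (fun z => Complex.exp (Complex.log (g z / g 0) / n)) 0 := by
    have h1 : AnalyticAt ℂ (fun z => g z / g 0) 0 := hg.div analyticAt_const hg0
    exact ((h1.clog (by simp [div_self hg0])).div analyticAt_const (by exact_mod_cast hn0)).cexp
  have hk : AnalyticAt ℂ k 0 := analyticAt_id.mul hE
  have hkd : deriv k 0 = 1 := by
    have := (hasDerivAt_id (0 : ℂ)).mul hE.differentiableAt.hasDerivAt
    have h2 : deriv k 0 = _ := this.deriv
    rw [h2]
    simp [div_self hg0]
  have hmap : map k (𝓝 0) = 𝓝 0 := by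
    have := (hk.hasStrictDerivAt).map_nhds_eq (by rw [hkd]; exact one_ne_zero)
    simpa [k] using this
  have hgne : ∀ᶠ z in 𝓝 (0 : ℂ), g z ≠ 0 := hg.continuousAt.eventually_ne hg0
  have hpow : ∀ᶠ z in 𝓝 (0 : ℂ), f z = g 0 * k z ^ n := by
    filter_upwards [hfg, hgne] with z hz hgz
    have : Complex.exp (Complex.log (g z / g 0) / n) ^ n = g z / g 0 := by
      rw [← Complex.exp_nat_mul, mul_div_cancel₀ _ (by exact_mod_cast hn0),
        Complex.exp_log (div_ne_zero hgz hg0)]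
    rw [hz, mul_pow, this]
    field_simp
  have hS : k '' (N ∩ {z | f z = g 0 * k z ^ n}) ∈ 𝓝 (0 : ℂ) := by
    rw [← hmap]
    exact image_mem_map (inter_mem hN hpow)
  obtain ⟨ε, hε, hball⟩ := Metric.mem_nhds_iff.1 hS
  have hω := Complex.isPrimitiveRoot_exp n hn0
  set ω := Complex.exp (2 * Real.pi * Complex.I / n)
  have hy1 : ((ε / 2 : ℝ) : ℂ) ∈ Metric.ball (0 : ℂ) ε := by
    rw [mem_ball_zero_iff, Complex.norm_real, Real.norm_eq_abs, abs_of_pos (by positivity)]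
    linarith
  have hy2 : ω * ((ε / 2 : ℝ) : ℂ) ∈ Metric.ball (0 : ℂ) ε := by
    rw [mem_ball_zero_iff, norm_mul, hω.norm'_eq_one hn0, one_mul]
    exact mem_ball_zero_iff.1 hy1
  obtain ⟨z1, ⟨hz1N, hz1⟩, hk1⟩ := hball hy1
  obtain ⟨z2, ⟨hz2N, hz2⟩, hk2⟩ := hball hy2
  have hff : f z1 = f z2 := by
    rw [hz1, hz2, hk1, hk2, mul_pow, hω.pow_eq_one, one_mul]
  have hzz := hinj hz1N hz2N hff
  rw [← hzz, hk1] at hk2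
  have hε' : ((ε / 2 : ℝ) : ℂ) ≠ 0 := by exact_mod_cast (by positivity : ε / 2 ≠ 0)
  have : ω = 1 := by
    have := mul_right_cancel₀ hε' (hk2.symm.trans (one_mul _).symm)
    exact this
  exact hω.ne_one (by omega) this

/-- The conical asymptotics of a metric does not depend on the local coordinate. -/
theorem tendsto_log_conformal_factor {f : ℂ → ℂ} {N : Set ℂ} (hN : N ∈ 𝓝 (0 : ℂ))
    (hf : AnalyticAt ℂ f 0) (hinj : InjOn f N) (h0 : f 0 = 0) {φ : ℂ → ℝ} {β L : ℝ}
    (hφ : Tendsto (fun x : ℂ => φ x - β * Real.log ‖x‖) (𝓝[≠] 0) (𝓝 L)) :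
    ∃ L' : ℝ, Tendsto (fun z => 2 * φ (f z) + 2 * Real.log ‖deriv f z‖ - 2 * β * Real.log ‖z‖)
      (𝓝[≠] 0) (𝓝 L') := by
  have hd := deriv_ne_zero_of_injOn hN hf hinj h0
  have hne : ∀ᶠ z in 𝓝[≠] (0 : ℂ), f z ≠ 0 := by
    filter_upwards [mem_nhdsWithin_of_mem_nhds hN, self_mem_nhdsWithin] with z hz hz0 h
    exact hz0 (hinj hz (mem_of_mem_nhds hN) (h.trans h0.symm))
  have hf0 : Tendsto f (𝓝[≠] 0) (𝓝[≠] 0) := by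
    refine tendsto_nhdsWithin_iff.2 ⟨?_, hne⟩
    have := hf.continuousAt.tendsto
    rw [h0] at this
    exact this.mono_left nhdsWithin_le_nhds
  have t1 := hφ.comp hf0
  have t2 : Tendsto (fun z => Real.log ‖deriv f z‖) (𝓝[≠] 0) (𝓝 (Real.log ‖deriv f 0‖)) := by
    have := hf.deriv.continuousAt.norm.log (norm_ne_zero_iff.2 hd)
    exact this.tendsto.mono_left nhdsWithin_le_nhds
  -- `log |f z|` and `log |z|` differ by the logarithm of a difference quotient, which converges.
  have t3 : Tendsto (fun z => Real.log ‖f z / z‖) (𝓝[≠] 0) (𝓝 (Real.log ‖deriv f 0‖)) := by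
    have h1 := hasDerivAt_iff_tendsto_slope.1 hf.differentiableAt.hasDerivAt
    refine (h1.norm.log (norm_ne_zero_iff.2 hd)).congr fun z => ?_
    simp [slope_def_field, h0]
  refine ⟨2 * L + 2 * Real.log ‖deriv f 0‖ + 2 * β * Real.log ‖deriv f 0‖, ?_⟩
  refine (((t1.const_mul 2).add (t2.const_mul 2)).add (t3.const_mul (2 * β))).congr' ?_
  filter_upwards [hne, self_mem_nhdsWithin] with z hz hz0
  rw [norm_div, Real.log_div (norm_ne_zero_iff.2 hz) (norm_ne_zero_iff.2 hz0)]
  simp only [Function.comp]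
  ring

theorem sphereAtInfinity_zero : sphereAtInfinity 0 = ∞ := by simp [sphereAtInfinity]

theorem sphereAtInfinity_of_ne_zero {w : ℂ} (hw : w ≠ 0) :
    sphereAtInfinity w = ((w⁻¹ : ℂ) : OnePoint ℂ) := by simp [sphereAtInfinity, hw]

theorem sphereAtInfinity_injective : Function.Injective sphereAtInfinity := by
  intro a b h
  by_cases ha : a = 0 <;> by_cases hb : b = 0
  · rw [ha, hb]
  · rw [ha, sphereAtInfinity_zero, sphereAtInfinity_of_ne_zero hb] at h
    exact absurd h (OnePoint.infty_ne_coe _)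
  · rw [hb, sphereAtInfinity_zero, sphereAtInfinity_of_ne_zero ha] at h
    exact absurd h (OnePoint.coe_ne_infty _)
  · rw [sphereAtInfinity_of_ne_zero ha, sphereAtInfinity_of_ne_zero hb] at h
    exact inv_injective (OnePoint.coe_injective h)

theorem continuousAt_sphereAtInfinity_zero : ContinuousAt sphereAtInfinity 0 := by
  rw [ContinuousAt, sphereAtInfinity_zero, ← nhdsNE_sup_pure, tendsto_sup]
  constructor
  · have h1 : Tendsto (fun w : ℂ => w⁻¹) (𝓝[≠] 0) (coclosedCompact ℂ) := by
      rw [coclosedCompact_eq_cocompact, ← Metric.cobounded_eq_cocompact]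
      exact tendsto_inv₀_nhdsNE_zero
    refine (OnePoint.tendsto_coe_infty.comp h1).congr' ?_
    filter_upwards [self_mem_nhdsWithin] with w hw
    exact (sphereAtInfinity_of_ne_zero hw).symm
  · rw [tendsto_pure_left]
    intro s hs
    rw [sphereAtInfinity_zero]
    exact mem_of_mem_nhds hs

namespace ConformalMetric

variable (g : ConformalMetric ({0}ᶜ : Set ℂ)) {α : ℝ}

theorem tendsto_log_density_zero (h : g.HasConicalSingularity ((0 : ℂ) : OnePoint ℂ) α) :
    ∃ L, Tendsto (fun z => Real.log (g.density z) - 2 * (α - 1) * Real.log ‖z‖) (𝓝[≠] 0)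
      (𝓝 L) := by
  obtain ⟨U, ζ, φ, hU, hg, L, hφ⟩ := h
  have hN : {z : ℂ | (z : OnePoint ℂ) ∈ U} ∈ 𝓝 (0 : ℂ) :=
    (hU.isOpen.preimage OnePoint.continuous_coe).mem_nhds hU.mem
  have hf : AnalyticAt ℂ (fun z : ℂ => ζ z) 0 := hU.holo.1.analyticAt hN
  have hinj : InjOn (fun z : ℂ => ζ z) {z : ℂ | (z : OnePoint ℂ) ∈ U} := fun a ha b hb hab =>
    OnePoint.coe_injective (hU.inj ha hb hab)
  obtain ⟨L', hL'⟩ := tendsto_log_conformal_factor hN hf hinj hU.zero hφ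
  refine ⟨L', hL'.congr' ?_⟩
  have hd := deriv_ne_zero_of_injOn hN hf hinj hU.zero
  filter_upwards [mem_nhdsWithin_of_mem_nhds hN, self_mem_nhdsWithin,
    (hf.deriv.continuousAt.eventually_ne hd).filter_mono nhdsWithin_le_nhds] with z hz hz0 hzd
  obtain ⟨z', -, hz', hρ⟩ := hg z hz (fun h => hz0 (OnePoint.coe_injective h))
  obtain rfl := OnePoint.coe_injective hz'
  rw [hρ, Real.log_mul (Real.exp_ne_zero _) (pow_ne_zero 2 (norm_ne_zero_iff.2 hzd)), Real.log_exp,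
    Real.log_pow]
  push_cast; ring

/-- The exponent is `α + 1` because the derivative of `z ↦ 1/z` contributes a factor `|w|⁴` to the
density: `2(α - 1) + 4 = 2(α + 1)`. -/
theorem tendsto_log_density_infty (h : g.HasConicalSingularity ∞ α) :
    ∃ L, Tendsto (fun w => Real.log (g.density w⁻¹) - 2 * (α + 1) * Real.log ‖w‖) (𝓝[≠] 0)
      (𝓝 L) := by
  obtain ⟨U, ζ, φ, hU, hg, L, hφ⟩ := h
  set f : ℂ → ℂ := fun w => ζ (sphereAtInfinity w) with hfdef
  have hN : {w : ℂ | sphereAtInfinity w ∈ U} ∈ 𝓝 (0 : ℂ) :=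
    continuousAt_sphereAtInfinity_zero.preimage_mem_nhds
      (by rw [sphereAtInfinity_zero]; exact hU.isOpen.mem_nhds hU.mem)
  have hf : AnalyticAt ℂ f 0 := hU.holo.2.analyticAt hN
  have hinj : InjOn f {w : ℂ | sphereAtInfinity w ∈ U} := fun a ha b hb hab =>
    sphereAtInfinity_injective (hU.inj ha hb hab)
  have hf0 : f 0 = 0 := by rw [hfdef]; simp only [sphereAtInfinity_zero, hU.zero]
  obtain ⟨L', hL'⟩ := tendsto_log_conformal_factor hN hf hinj hf0 hφ
  refine ⟨L', hL'.congr' ?_⟩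
  have hd := deriv_ne_zero_of_injOn hN hf hinj hf0
  filter_upwards [mem_nhdsWithin_of_mem_nhds hN, self_mem_nhdsWithin,
    (hf.deriv.continuousAt.eventually_ne hd).filter_mono nhdsWithin_le_nhds,
    hf.eventually_analyticAt.filter_mono nhdsWithin_le_nhds] with w hw hw0 hwd hwa
  have hw0' : w ≠ 0 := hw0
  obtain ⟨z, -, hz, hρ⟩ := hg _ hw (fun h => hw0' (sphereAtInfinity_injective
    (h.trans sphereAtInfinity_zero.symm)))
  have hzw : w⁻¹ = z := by
    rw [sphereAtInfinity_of_ne_zero hw0'] at hz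
    exact OnePoint.coe_injective hz
  subst hzw
  have hder : deriv (fun x : ℂ => ζ (x : OnePoint ℂ)) w⁻¹ = deriv f w * -(w ^ 2) := by
    have heq : (fun x : ℂ => ζ (x : OnePoint ℂ)) =ᶠ[𝓝 w⁻¹] fun x => f x⁻¹ := by
      filter_upwards [isOpen_compl_singleton.mem_nhds (inv_ne_zero hw0')] with x hx
      rw [hfdef]
      simp only [sphereAtInfinity_of_ne_zero (inv_ne_zero hx), inv_inv]
    rw [heq.deriv_eq]
    have h1 : HasDerivAt f (deriv f w) (w⁻¹)⁻¹ := by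
      rw [inv_inv]; exact hwa.differentiableAt.hasDerivAt
    have h2 := h1.comp w⁻¹ (hasDerivAt_inv (inv_ne_zero hw0'))
    have h3 : deriv (fun x => f x⁻¹) w⁻¹ = _ := h2.deriv
    rw [h3]
    simp
  have hζ : ζ ((w⁻¹ : ℂ) : OnePoint ℂ) = f w := by
    rw [hfdef]; simp only [sphereAtInfinity_of_ne_zero hw0']
  have n1 : ‖deriv f w‖ ≠ 0 := norm_ne_zero_iff.2 hwd
  have n2 : ‖w‖ ≠ 0 := norm_ne_zero_iff.2 hw0'
  rw [hρ, hder, hζ, norm_mul, norm_neg, norm_pow, Real.log_mul (Real.exp_ne_zero _) (by positivity),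
    Real.log_exp, Real.log_pow, Real.log_mul n1 (by positivity), Real.log_pow]
  push_cast; ring

theorem tendsto_logDensity_atBot (h : g.HasConicalSingularity ((0 : ℂ) : OnePoint ℂ) α) :
    ∃ L, Tendsto (fun s : ℂ => g.logDensity s - 2 * α * s.re) (comap Complex.re atBot) (𝓝 L) := by
  obtain ⟨L, hL⟩ := g.tendsto_log_density_zero h
  refine ⟨L, (hL.comp Complex.tendsto_exp_comap_re_atBot_nhdsNE).congr fun s => ?_⟩
  simp only [Function.comp, Complex.norm_exp, Real.log_exp, logDensity]
  ring

theorem tendsto_logDensity_atTop (h : g.HasConicalSingularity ∞ α) :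
    ∃ L, Tendsto (fun s : ℂ => g.logDensity s + 2 * α * s.re) (comap Complex.re atTop) (𝓝 L) := by
  obtain ⟨L, hL⟩ := g.tendsto_log_density_infty h
  have hneg : Tendsto (fun s : ℂ => -s) (comap Complex.re atTop) (comap Complex.re atBot) :=
    tendsto_comap_iff.2 (tendsto_neg_atTop_atBot.comp tendsto_comap)
  refine ⟨L, (hL.comp (Complex.tendsto_exp_comap_re_atBot_nhdsNE.comp hneg)).congr fun s => ?_⟩
  simp only [Function.comp, Complex.norm_exp, Real.log_exp, logDensity, Complex.exp_neg, inv_inv,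
    norm_inv, Real.log_inv]
  ring

end ConformalMetric

/-! ### Periodicity and the normal forms -/

theorem rpow_two_mul_sub_one {t α : ℝ} (ht : 0 < t) :
    t ^ (2 * (α - 1)) = (t ^ α) ^ 2 / t ^ 2 := by
  rw [← Real.rpow_natCast (t ^ α) 2, ← Real.rpow_natCast t 2, ← Real.rpow_mul ht.le,
    ← Real.rpow_sub ht]
  congr 1
  push_cast; ring

theorem rpow_two_mul_eq_sq {t α : ℝ} (ht : 0 < t) : t ^ (2 * α) = (t ^ α) ^ 2 := by
  rw [← Real.rpow_natCast (t ^ α) 2, ← Real.rpow_mul ht.le]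
  congr 1
  push_cast; ring

/-- The phases `αy = 0` and `αy = π/2` give a linear system for `(c, d)` with determinant `(cos 2πα
- 1)² + sin² 2πα`, which vanishes only for integral `α`. -/
theorem eq_zero_of_cos_sin_periodic {α c d : ℝ} (hα : 0 < α)
    (hint : ¬ ∃ n : ℕ, 0 < n ∧ α = n)
    (h : ∀ y : ℝ, c * Real.cos (α * (y + 2 * Real.pi)) + d * Real.sin (α * (y + 2 * Real.pi)) =
      c * Real.cos (α * y) + d * Real.sin (α * y)) : c = 0 ∧ d = 0 := by
  have h0 := h 0
  have h1 := h (Real.pi / 2 / α)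
  have e : α * (Real.pi / 2 / α + 2 * Real.pi) = α * (2 * Real.pi) + Real.pi / 2 := by
    field_simp; ring
  have e' : α * (Real.pi / 2 / α) = Real.pi / 2 := by field_simp
  rw [e, e', Real.cos_add_pi_div_two, Real.sin_add_pi_div_two, Real.cos_pi_div_two,
    Real.sin_pi_div_two] at h1
  simp only [zero_add, mul_zero, Real.cos_zero, Real.sin_zero] at h0
  have hcos : Real.cos (α * (2 * Real.pi)) ≠ 1 := by
    intro hc
    obtain ⟨k, hk⟩ := (Real.cos_eq_one_iff _).1 hc
    have hk' : α = k := by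
      have := mul_right_cancel₀ (Real.two_pi_pos.ne') hk
      exact this.symm
    have hk0 : 0 < k := by
      rw [hk'] at hα
      exact_mod_cast hα
    lift k to ℕ using hk0.le
    exact hint ⟨k, by exact_mod_cast hk0, by exact_mod_cast hk'⟩
  set C := Real.cos (α * (2 * Real.pi))
  set S := Real.sin (α * (2 * Real.pi))
  have hpos : 0 < (C - 1) ^ 2 + S ^ 2 := by
    have : 0 < (C - 1) ^ 2 := by
      have := sub_ne_zero.2 hcos
      positivity
    nlinarith [sq_nonneg S]
  constructor
  · have : c * ((C - 1) ^ 2 + S ^ 2) = 0 := by linear_combination (C - 1) * h0 - S * h1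
    exact (mul_eq_zero.1 this).resolve_right hpos.ne'
  · have : d * ((C - 1) ^ 2 + S ^ 2) = 0 := by linear_combination S * h0 + (C - 1) * h1
    exact (mul_eq_zero.1 this).resolve_right hpos.ne'

/-- The general form of a metric of curvature one with two conical points of the same angle. -/
theorem ConformalMetric.exists_density_eq {α : ℝ} (hα : 0 < α)
    (g : ConformalMetric ({0}ᶜ : Set ℂ))
    (hK : ∀ z : ℂ, z ≠ 0 → g.gaussCurvature z = 1)
    (h0 : g.HasConicalSingularity ((0 : ℂ) : OnePoint ℂ) α)
    (hinf : g.HasConicalSingularity ∞ α) :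
    ∃ a b c d : ℝ, 0 < a ∧ 0 < b ∧ α ^ 2 * (4 * a * b - c ^ 2 - d ^ 2) = 1 ∧
      (∀ y : ℝ, c * Real.cos (α * (y + 2 * Real.pi)) + d * Real.sin (α * (y + 2 * Real.pi)) =
        c * Real.cos (α * y) + d * Real.sin (α * y)) ∧
      ∀ z : ℂ, z ≠ 0 → g.density z * (‖z‖ * (a * ‖z‖ ^ α + b * (‖z‖ ^ α)⁻¹ +
        c * Real.cos (α * z.arg) + d * Real.sin (α * z.arg))) ^ 2 = 1 := by
  obtain ⟨L, hL⟩ := g.tendsto_logDensity_atBot h0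
  obtain ⟨L', hL'⟩ := g.tendsto_logDensity_atTop hinf
  have hS := schwarzShift_eq_zero g.contDiff_logDensity (g.lap_logDensity hK) g.logDensity_periodic
    hα hL hL'
  obtain ⟨a, b, c, d, ha, hb, hrel, hV⟩ := exists_exp_neg_half_eq g.contDiff_logDensity
    (g.lap_logDensity hK) hα.ne' hS
  refine ⟨a, b, c, d, ha, hb, hrel, fun y => ?_, fun z hz => ?_⟩
  -- On the imaginary axis the exponential terms are constant, so periodicity concerns the
  -- trigonometric part alone.
  · have h1 := hV (y * Complex.I)
    have h2 := hV (y * Complex.I + 2 * Real.pi * Complex.I)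
    rw [g.logDensity_periodic, h1] at h2
    simp at h2
    linarith
  · have h1 := hV (Complex.log z)
    have hz' : 0 < ‖z‖ := norm_pos_iff.2 hz
    rw [Complex.log_re, Complex.log_im, Real.exp_neg, mul_comm α (Real.log ‖z‖),
      ← Real.rpow_def_of_pos hz'] at h1
    have h2 := g.exp_logDensity (Complex.log z)
    rw [Complex.exp_log hz, Complex.normSq_eq_norm_sq] at h2
    rw [← h1, mul_pow, ← mul_assoc, mul_comm (g.density z), ← h2, ← Real.exp_nat_mul,
      ← Real.exp_add]
    simp

theorem theorem1p2 (α : ℝ) (hα : 0 < α) (hα1 : α ≠ 1)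
    (g : ConformalMetric ({0}ᶜ : Set ℂ))
    (hK : ∀ z : ℂ, z ≠ 0 → g.gaussCurvature z = 1)
    (h0 : g.HasConicalSingularity ((0 : ℂ) : OnePoint ℂ) α)
    (hinf : g.HasConicalSingularity ∞ α) :
    ((¬ ∃ n : ℕ, 0 < n ∧ α = n) →
      ∃ p : ℂ, p ≠ 0 ∧ ∀ w : ℂ, w ≠ 0 →
        g.densityInCoordinate (fun x => p * x) w =
          4 * α ^ 2 * ‖w‖ ^ (2 * (α - 1)) / (1 + ‖w‖ ^ (2 * α)) ^ 2) ∧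
    (∀ n : ℕ, 0 < n → α = n →
      ∃ (p : ℂ) (b : ℝ), p ≠ 0 ∧ ∀ w : ℂ, w ≠ 0 →
        g.densityInCoordinate (fun x => p * x) w =
          4 * α ^ 2 * ‖w‖ ^ (2 * (α - 1)) / (1 + ‖w ^ n + (b : ℂ)‖ ^ 2) ^ 2) := by
  obtain ⟨a, b, c, d, ha, hb, hrel, hper, hden⟩ := g.exists_density_eq hα hK h0 hinf
  have hderiv : ∀ p w : ℂ, deriv (fun x => p * x) w = p := fun p w => by
    simp
  constructor
  · intro hint
    obtain ⟨rfl, rfl⟩ := eq_zero_of_cos_sin_periodic hα hint hper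
    have hrel' : α ^ 2 * (4 * a * b) = 1 := by linarith
    -- This scale makes the two coefficients agree: `a P^α = b P^{-α}`.
    obtain ⟨P, hP, hPα⟩ : ∃ P : ℝ, 0 < P ∧ (P ^ α) ^ 2 = b / a := by
      refine ⟨(b / a) ^ (1 / (2 * α)), by positivity, ?_⟩
      rw [← Real.rpow_natCast, ← Real.rpow_mul (by positivity), ← Real.rpow_mul (by positivity)]
      have : 1 / (2 * α) * (α * ((2 : ℕ) : ℝ)) = 1 := by push_cast; field_simp
      rw [this, Real.rpow_one]
    refine ⟨P, by exact_mod_cast hP.ne', fun w hw => ?_⟩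
    have ht : 0 < ‖w‖ := norm_pos_iff.2 hw
    have hnP : ‖(P : ℂ)‖ = P := by rw [Complex.norm_real, Real.norm_eq_abs, abs_of_pos hP]
    have h := hden (P * w) (mul_ne_zero (by exact_mod_cast hP.ne') hw)
    rw [norm_mul, hnP, Real.mul_rpow hP.le ht.le] at h
    simp only [zero_mul, add_zero] at h
    rw [ConformalMetric.densityInCoordinate, hderiv, hnP, rpow_two_mul_sub_one ht,
      rpow_two_mul_eq_sq ht]
    have hY : 0 < P ^ α := by positivity
    have hX : 0 < ‖w‖ ^ α := by positivity
    generalize P ^ α = Y at *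
    generalize ‖w‖ ^ α = X at *
    have hV : a * (Y * X) + b * (Y * X)⁻¹ = b * (1 + X ^ 2) / (Y * X) := by
      have : a * Y ^ 2 = b := by rw [hPα]; field_simp
      field_simp
      linear_combination X ^ 2 * this
    rw [hV] at h
    have hY2 : 4 * α ^ 2 = Y ^ 2 / b ^ 2 := by
      rw [hPα]; field_simp; linarith
    rw [hY2]
    field_simp at h ⊢
    linarith
  · intro n hn hαn
    -- `β` completes the square: with `R = |z|^n`, the bracket times `R` equals `a |z^n + β̄'|² + 1
    -- / (4aα²)`, where `β̄' = β` and the constant comes from `hrel`.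
    obtain ⟨β, hβ⟩ : ∃ β : ℂ, β = ⟨c / (2 * a), d / (2 * a)⟩ := ⟨_, rfl⟩
    -- The modulus of `lam = p^n` scales the square so that the constant term becomes `1`; its
    -- argument, that of `β`, makes `b = β / lam` real.
    have hk : 0 < 1 / (2 * a * α) := by positivity
    obtain ⟨lam, hlam⟩ : ∃ lam : ℂ,
        lam = ((1 / (2 * a * α) : ℝ) : ℂ) * Complex.exp (β.arg * Complex.I) := ⟨_, rfl⟩
    have hlam_norm : ‖lam‖ = 1 / (2 * a * α) := by
      rw [hlam, norm_mul, Complex.norm_exp_ofReal_mul_I, mul_one, Complex.norm_real,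
        Real.norm_eq_abs, abs_of_pos hk]
    have hβlam : β = lam * ((‖β‖ * (2 * a * α) : ℝ) : ℂ) := by
      have hkc : ((1 / (2 * a * α) : ℝ) : ℂ) * ((‖β‖ * (2 * a * α) : ℝ) : ℂ) = ‖β‖ := by
        rw [← Complex.ofReal_mul]
        congr 1
        field_simp
      rw [hlam, mul_right_comm, hkc, Complex.norm_mul_exp_arg_mul_I]
    obtain ⟨p, hp⟩ := IsAlgClosed.exists_pow_nat_eq lam hn
    have hp0 : p ≠ 0 := by
      rintro rfl
      rw [zero_pow hn.ne'] at hp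
      rw [← hp, norm_zero] at hlam_norm
      exact hk.ne hlam_norm
    refine ⟨p, ‖β‖ * (2 * a * α), hp0, fun w hw => ?_⟩
    have ht : 0 < ‖w‖ := norm_pos_iff.2 hw
    have hpn : 0 < ‖p‖ := norm_pos_iff.2 hp0
    have hz : p * w ≠ 0 := mul_ne_zero hp0 hw
    have hzn : 0 < ‖p * w‖ := norm_pos_iff.2 hz
    have h := hden (p * w) hz
    have hrp : ∀ t : ℝ, t ^ α = t ^ n := fun t => by rw [hαn, Real.rpow_natCast]
    rw [ConformalMetric.densityInCoordinate, hderiv, rpow_two_mul_sub_one ht]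
    rw [hrp] at h ⊢
    have hpolar : (p * w) ^ n = ((‖p * w‖ ^ n : ℝ) : ℂ) *
        (Real.cos (α * (p * w).arg) + Real.sin (α * (p * w).arg) * Complex.I) := by
      conv_lhs => rw [← Complex.norm_mul_exp_arg_mul_I (p * w)]
      rw [mul_pow, ← Complex.exp_nat_mul, Complex.ofReal_pow, ← mul_assoc,
        Complex.ofReal_cos, Complex.ofReal_sin, ← Complex.exp_mul_I, hαn]
      push_cast; rfl
    have hR : ‖p * w‖ ^ n = 1 / (2 * a * α) * ‖w‖ ^ n := by
      rw [norm_mul, mul_pow, ← norm_pow p, hp, hlam_norm]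
    have hsum : (p * w) ^ n + β = lam * (w ^ n + ((‖β‖ * (2 * a * α) : ℝ) : ℂ)) := by
      rw [mul_pow, hp, mul_add, ← hβlam]
    have hnorm : ‖(p * w) ^ n + β‖ ^ 2 =
        (1 / (2 * a * α)) ^ 2 * ‖w ^ n + ((‖β‖ * (2 * a * α) : ℝ) : ℂ)‖ ^ 2 := by
      rw [hsum, norm_mul, hlam_norm, mul_pow]
    rw [hpolar, ← Complex.normSq_eq_norm_sq, Complex.normSq_apply, hβ] at hnorm
    simp only [Complex.add_re, Complex.add_im, Complex.ofReal_re, Complex.ofReal_im, Complex.mul_re,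
      Complex.mul_im, Complex.I_re, Complex.I_im, mul_zero, mul_one, sub_zero, add_zero, zero_add] at hnorm
    rw [← hβ] at hnorm
    have hcs := Real.sin_sq_add_cos_sq (α * (p * w).arg)
    have hRpos : 0 < ‖p * w‖ ^ n := by positivity
    have hT : 0 < ‖w‖ ^ n := by positivity
    have hN : 0 ≤ ‖w ^ n + ((‖β‖ * (2 * a * α) : ℝ) : ℂ)‖ ^ 2 := by positivity
    generalize ‖w ^ n + ((‖β‖ * (2 * a * α) : ℝ) : ℂ)‖ ^ 2 = N at *
    generalize Real.cos (α * (p * w).arg) = C at *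
    generalize Real.sin (α * (p * w).arg) = S at *
    have hzmul : ‖p * w‖ = ‖p‖ * ‖w‖ := norm_mul _ _
    generalize ‖p * w‖ ^ n = R at *
    generalize ‖w‖ ^ n = T at *
    -- From here everything is a rational identity; the only relations used are `hnorm`, `hrel` and
    -- `C² + S² = 1`.
    have hV : (a * R + b * R⁻¹ + c * C + d * S) * R = (1 + N) / (4 * a * α ^ 2) := by
      have e1 : (a * R + b * R⁻¹ + c * C + d * S) * R =
          a * R ^ 2 + b + c * (R * C) + d * (R * S) := by
        field_simp
      have e2 : N = (2 * a * α) ^ 2 * ((R * C + c / (2 * a)) * (R * C + c / (2 * a)) +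
          (R * S + d / (2 * a)) * (R * S + d / (2 * a))) := by
        have e3 : (R * C + c / (2 * a)) * (R * C + c / (2 * a)) +
            (R * S + d / (2 * a)) * (R * S + d / (2 * a)) = (1 / (2 * a * α)) ^ 2 * N := by
          linear_combination hnorm
        rw [e3]; field_simp
      rw [e1, e2]
      field_simp
      linear_combination hrel - (4 * a ^ 2 * α ^ 2 * R ^ 2) * hcs
    have hV' : a * R + b * R⁻¹ + c * C + d * S = (1 + N) / (2 * α * T) := by
      rw [eq_div_iff (by positivity)]
      rw [hR] at hV ⊢
      field_simp at hV ⊢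
      linarith
    rw [hV', hzmul] at h
    have hN1 : 0 < 1 + N := by linarith
    field_simp at h ⊢
    linarith
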